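/- **Theorem.** Let $n\ge 1$, $k\in\{1,\dots,n\}$, $a<b$, let $A:[a,b]\to\mathbb R^{n\times n}$ be continuous, and consider the linear time-varying system $\dot x(t)=A(t)x(t)$, $t\in[a,b]$. For $x\in\mathbb R^n$ let $s^-(x)$ be the number of sign changes in $x$ after deleting its zero entries ($s^-(0)=0$), and let $s^+(x)$ be the maximal number of sign changes in a vector obtained from $x$ by replacing each zero entry by $1$ or $-1$. Put $P^k_-=\{z\in\mathbb R^n: s^-(z)\le k-1\}$ and $P^k_+=\{z\in\mathbb R^n: s^+(z)\le k-1\}$. The system is called *$k$-positive on $[a,b]$* if every solution $x$ on $[a,b]$ and all $t_0\in(a,b)$ satisfy $$x(t_0)\in P^k_-\ \Longrightarrow\ x(t)\in P^k_-\ \text{ for all } t_0\le t<b,$$ and *strongly $k$-positive on $[a,b]$* if every solution $x$ on $[a,b]$ and all $t_0\in(a,b)$ satisfy $$0\ne x(t_0)\in P^k_-\ \Longrightarrow\ x(t)\in P^k_+\ \text{ for all } t_0<t<b.$$ For $M\in\mathbb R^{n\times n}$ let $M^{(k)}$ be the $\binom nk\times\binom nk$ matrix of all $k\times k$ minors of $M$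 (rows and columns indexed by the increasing sequences of length $k$ in $\{1,\dots,n\}$), and let $M^{[k]}=\frac{d}{d\varepsilon}(I+\varepsilon M)^{(k)}\big|_{\varepsilon=0}$ be the $k$-additive compound of $M$; write $A^{[k]}(t)=(A(t))^{[k]}$. A square matrix is Metzler if its off-diagonal entries are nonnegative. It is reducible if a simultaneous permutation of rows and columns makes it block triangular with at least two diagonal blocks, and irreducible otherwise (so $1\times1$ matrices are irreducible). Let $E$ be the set of $t\in(a,b)$ for which $A^{[k]}(t)$ is reducible. Then: 1. The system is $k$-positive on $[a,b]$ if and only if $A^{[k]}(t)$ is Metzler for all $t\in(a,b)$. 2. The system is strongly $k$-positive on $[a,b]$ if and only if $A^{[k]}(t)$ is Metzler for all $t\in(a,b)$ and $A^{[k]}(t)$ is irreducible for all $t\in(a,b)$ except, perhaps, on a set of times that contains no interval of positive length (that is, $E$ has empty interior). 3. In particular, if $A^{[k]}(t)$ is Metzler for all $t\in(a,b)$ and irreducible except, perhaps, at isolated times (every point of $E$ is an isolated point of $E$), then the system is strongly $k$-positive on $[a,b]$. -/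

import Mathlib

open Set Filter Topology

noncomputable section

namespace KPositive

/-- `s⁻(x)`: the number of sign variations of `x` after deleting its zero entries, i.e. the number
of pairs `i < j` such that `x i`, `x j` are consecutive among the nonzero entries of `x` and have
opposite signs. In particular `s⁻(0) = 0`. -/
def sMinus {n : ℕ} (x : Fin n → ℝ) : ℕ :=
  {p : Fin n × Fin n | p.1 < p.2 ∧ x p.1 * x p.2 < 0 ∧
    ∀ l : Fin n, p.1 < l → l < p.2 → x l = 0}.ncard

/-- `s⁺(x)`: the maximal number of sign variations of `x` over all ways of replacing each zero
entry of `x` by `1` or `-1`. -/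
def sPlus {n : ℕ} (x : Fin n → ℝ) : ℕ :=
  Finset.univ.sup fun ε : Fin n → ℤˣ =>
    sMinus fun i => if x i = 0 then ((ε i : ℤ) : ℝ) else x i

/-- `P₋ᵏ`, the vectors with `s⁻ ≤ k - 1` (used for `1 ≤ k` only). -/
def PMinus (n k : ℕ) : Set (Fin n → ℝ) := {z | sMinus z ≤ k - 1}

/-- `P₊ᵏ`, the vectors with `s⁺ ≤ k - 1` (used for `1 ≤ k` only). -/
def PPlus (n k : ℕ) : Set (Fin n → ℝ) := {z | sPlus z ≤ k - 1}

/-- The `k`-multiplicative compound `A^(k)`: the matrix of all `k × k` minors. Rows and columns are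
indexed by the strictly increasing sequences of length `k` in `Fin n`. -/
def multCompound {n : ℕ} (k : ℕ) (A : Matrix (Fin n) (Fin n) ℝ) :
    Matrix (Fin k ↪o Fin n) (Fin k ↪o Fin n) ℝ :=
  Matrix.of fun α β => (A.submatrix α β).det

/-- The `k`-additive compound `A^[k]`: the derivative of `(I + ε A)^(k)` at `ε = 0`, taken
entrywise (each entry is a polynomial in `ε`). -/
def addCompound {n : ℕ} (k : ℕ) (A : Matrix (Fin n) (Fin n) ℝ) :
    Matrix (Fin k ↪o Fin n) (Fin k ↪o Fin n) ℝ :=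
  Matrix.of fun α β => deriv (fun ε : ℝ => multCompound k (1 + ε • A) α β) 0

/-- Metzler matrices: all off-diagonal entries are nonnegative. -/
def IsMetzler {ι : Type*} (M : Matrix ι ι ℝ) : Prop :=
  ∀ i j, i ≠ j → 0 ≤ M i j

/-- Irreducible matrices (of arbitrary sign): no simultaneous permutation of rows and columns
brings `M` to a block triangular form with at least two diagonal blocks. A `1 × 1` matrix is
irreducible. -/
def IsIrreducibleMatrix {ι : Type*} (M : Matrix ι ι ℝ) : Prop :=
  ∀ S : Set ι, S.Nonempty → Sᶜ.Nonempty → ∃ i ∈ S, ∃ j ∈ Sᶜ, M i j ≠ 0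

/-- `x` solves `ẋ(t) = A(t) x(t)` on `[a, b]` (one-sided derivatives at the endpoints). -/
def IsSolution {n : ℕ} (A : ℝ → Matrix (Fin n) (Fin n) ℝ) (a b : ℝ) (x : ℝ → Fin n → ℝ) : Prop :=
  ∀ t ∈ Icc a b, HasDerivWithinAt x ((A t).mulVec (x t)) (Icc a b) t

/-- The system `ẋ = A(t) x` is `k`-positive on `[a, b]`. -/
def IsKPositive {n : ℕ} (k : ℕ) (A : ℝ → Matrix (Fin n) (Fin n) ℝ) (a b : ℝ) : Prop :=
  ∀ x : ℝ → Fin n → ℝ, IsSolution A a b x → ∀ t₀, a < t₀ → t₀ < b →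
    x t₀ ∈ PMinus n k → ∀ t, t₀ ≤ t → t < b → x t ∈ PMinus n k

/-- The system `ẋ = A(t) x` is strongly `k`-positive on `[a, b]`. The zero solution is left out:
`s⁻(0) = 0`, whereas `s⁺(0) = n - 1`. -/
def IsStronglyKPositive {n : ℕ} (k : ℕ) (A : ℝ → Matrix (Fin n) (Fin n) ℝ) (a b : ℝ) : Prop :=
  ∀ x : ℝ → Fin n → ℝ, IsSolution A a b x → ∀ t₀, a < t₀ → t₀ < b → x t₀ ≠ 0 →
    x t₀ ∈ PMinus n k → ∀ t, t₀ < t → t < b → x t ∈ PPlus n k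

/-- The times in `(a, b)` at which `A^[k](t)` is reducible. -/
def reducibleTimes {n : ℕ} (k : ℕ) (A : ℝ → Matrix (Fin n) (Fin n) ℝ) (a b : ℝ) : Set ℝ :=
  {t ∈ Ioo a b | ¬ IsIrreducibleMatrix (addCompound k (A t))}

end KPositive

end

/-!
The minors of order `k` of a matrix solution `Ẋ = A(t) X` with `k` columns form a vector `w` with
`ẇ = A^[k](t) w` (`IsMatrixSolution.hasDerivAt_minors`, from the Cauchy–Binet formula). So the
theorem compares positivity of this linear system with sign variations of solutions of the
original one.

*Sufficiency.* A vector with at most `k - 1` sign variations is a combination of the columns of a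
matrix `U` whose minors are nonnegative and not all zero (`exists_matrix_of_mem_PMinus`). Let `X`
be the matrix solution through `U`. If `A^[k]` is Metzler, the minors of `X` stay nonnegative and
not all zero; if moreover `A^[k]` is irreducible at a dense set of times, they become positive at
once (`pos_of_isIrreducibleMatrix`): coordinates of `w` once positive stay positive, so if some
coordinate vanished at a later time, the set of vanishing coordinates would be constant, nonempty
and proper on some interval, and `A^[k]` would be reducible throughout it. If all minors of `X`
are positive, then `X d` has at most `k - 1` weak sign variations for every `d ≠ 0`: otherwise the
`(k + 1) × (k + 1)` determinant of `[X d | X]` along a weakly alternating subsequence would vanish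
without cancellation (`mulVec_mem_PPlus`). When the minors are only nonnegative, they are first
made positive by following for a short time the flow of the path matrix, all of whose additive
compounds are Metzler and irreducible (`mulVec_mem_PMinus`).

*Necessity.* A negative off-diagonal entry of `A^[k](t₀)` is up to sign an entry of `A(t₀)`, and
it produces a solution with `k` nonzero entries at `t₀` whose next entry appears with the sign
that creates a `k`-th sign variation (`isMetzler_of_isKPositive`). If `A^[k]` is reducible on an
interval, it has the same block triangular form on a smaller one, so some minor of a suitable
matrix solution stays zero. A combination of the columns then vanishes at `k` places, and has `k`
weak sign variations although it started with at most `k - 1`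
(`interior_reducibleTimes_eq_empty`).
-/

namespace KPositive

/-! ### Minors: the Cauchy–Binet formula and derivatives of determinants -/

theorem orderEmb_eq_of_range_eq {k n : ℕ} {α β : Fin k ↪o Fin n}
    (h : Set.range α = Set.range β) : α = β :=
  DFunLike.coe_injective ((StrictMono.range_inj α.strictMono β.strictMono).1 h)

theorem orderEmb_eq_of_range_subset {k n : ℕ} {α β : Fin k ↪o Fin n}
    (h : Set.range α ⊆ Set.range β) : α = β := by
  refine orderEmb_eq_of_range_eq (Set.eq_of_subset_of_ncard_le h ?_)
  rw [← Set.image_univ, ← Set.image_univ, Set.ncard_image_of_injective _ α.injective,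
    Set.ncard_image_of_injective _ β.injective]

/-- An injective map from `Fin k` to `Fin n` factors as a permutation followed by an increasing
map. -/
theorem exists_orderEmb_comp_perm {k n : ℕ} {p : Fin k → Fin n} (hp : Function.Injective p) :
    ∃ (β : Fin k ↪o Fin n) (σ : Equiv.Perm (Fin k)), (fun i => β (σ i)) = p := by
  have hs : StrictMono (p ∘ Tuple.sort p) :=
    (Tuple.monotone_sort p).strictMono_of_injective (hp.comp (Tuple.sort p).injective)
  refine ⟨OrderEmbedding.ofStrictMono _ hs, (Tuple.sort p)⁻¹, ?_⟩
  ext i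
  simp

theorem det_mul_eq_sum_functions {k n : ℕ} (M : Matrix (Fin k) (Fin n) ℝ)
    (N : Matrix (Fin n) (Fin k) ℝ) :
    (M * N).det = ∑ p : Fin k → Fin n, (∏ i, N (p i) i) * (M.submatrix id p).det := by
  simp only [Matrix.det_apply', Matrix.mul_apply, Finset.prod_univ_sum, Finset.mul_sum,
    Fintype.piFinset_univ, Finset.prod_mul_distrib, Matrix.submatrix_apply, id]
  rw [Finset.sum_comm]
  refine Finset.sum_congr rfl fun p _ => Finset.sum_congr rfl fun σ _ => ?_
  ring

/-- The Cauchy–Binet formula. -/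
theorem det_mul_eq_sum_minors {k n : ℕ} (M : Matrix (Fin k) (Fin n) ℝ)
    (N : Matrix (Fin n) (Fin k) ℝ) :
    (M * N).det = ∑ β : Fin k ↪o Fin n, (M.submatrix id β).det * (N.submatrix β id).det := by
  classical
  have h1 : ∀ β : Fin k ↪o Fin n, (M.submatrix id β).det * (N.submatrix β id).det =
      ∑ σ : Equiv.Perm (Fin k),
        (∏ i, N (β (σ i)) i) * (M.submatrix id fun i => β (σ i)).det := by
    intro β
    rw [Matrix.det_apply' (N.submatrix β id), Finset.mul_sum]
    refine Finset.sum_congr rfl fun σ _ => ?_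
    have : (M.submatrix id fun i => β (σ i)) = (M.submatrix id β).submatrix id σ := rfl
    rw [this, Matrix.det_permute']
    simp only [Matrix.submatrix_apply, id]
    ring
  simp_rw [h1]
  rw [det_mul_eq_sum_functions, ← Fintype.sum_prod_type'
    (f := fun (β : Fin k ↪o Fin n) (σ : Equiv.Perm (Fin k)) =>
      (∏ i, N (β (σ i)) i) * (M.submatrix id fun i => β (σ i)).det)]
  symm
  refine Finset.sum_of_injOn (fun q : (Fin k ↪o Fin n) × Equiv.Perm (Fin k) => fun i => q.1 (q.2 i))
    ?_ (fun _ _ => Finset.mem_coe.2 (Finset.mem_univ _)) ?_ (fun _ _ => rfl)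
  · rintro ⟨β, σ⟩ - ⟨β', σ'⟩ - h
    have h : ∀ i, β (σ i) = β' (σ' i) := fun i => congrFun h i
    have hβ : β = β' := by
      apply orderEmb_eq_of_range_eq
      rw [← σ.surjective.range_comp β, ← σ'.surjective.range_comp β']
      exact congrArg _ (funext h)
    subst hβ
    have : σ = σ' := Equiv.ext fun i => β.injective (h i)
    rw [this]
  · -- only injective maps contribute, since otherwise two columns of the minor agree
    intro p _ hp
    have hninj : ¬ Function.Injective p := by
      intro hinj
      obtain ⟨β, σ, h⟩ := exists_orderEmb_comp_perm hinj
      exact hp ⟨(β, σ), by simp, h⟩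
    rw [Function.not_injective_iff] at hninj
    obtain ⟨i, j, hij, hne⟩ := hninj
    rw [Matrix.det_zero_of_column_eq hne (fun r => by simp [hij]), mul_zero]

theorem det_updateCol_eq_sum {k : ℕ} (M : Matrix (Fin k) (Fin k) ℝ) (c : Fin k)
    (v : Fin k → ℝ) :
    (M.updateCol c v).det = ∑ σ : Equiv.Perm (Fin k), ((Equiv.Perm.sign σ : ℤ) : ℝ) *
      ((∏ j ∈ Finset.univ.erase c, M (σ j) j) * v (σ c)) := by
  rw [Matrix.det_apply']
  refine Finset.sum_congr rfl fun σ _ => ?_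
  rw [← Finset.prod_erase_mul Finset.univ _ (Finset.mem_univ c), Matrix.updateCol_self]
  congr 2
  exact Finset.prod_congr rfl fun j hj => Matrix.updateCol_ne (Finset.ne_of_mem_erase hj)

/-- Jacobi's rule: the derivative of a determinant is obtained by differentiating one column at a
time. -/
theorem hasDerivAt_det {k : ℕ} {M : ℝ → Matrix (Fin k) (Fin k) ℝ} {M' : Matrix (Fin k) (Fin k) ℝ}
    {t : ℝ} (h : ∀ i j, HasDerivAt (fun s => M s i j) (M' i j) t) :
    HasDerivAt (fun s => (M s).det) (∑ c, ((M t).updateCol c fun r => M' r c).det) t := by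
  simp_rw [det_updateCol_eq_sum]
  simp only [Matrix.det_apply']
  rw [Finset.sum_comm]
  refine HasDerivAt.fun_sum fun σ _ => ?_
  rw [← Finset.mul_sum]
  refine HasDerivAt.const_mul _ ?_
  simpa [smul_eq_mul] using HasDerivAt.fun_finsetProd (u := Finset.univ)
    (f := fun j s => M s (σ j) j) (f' := fun j => M' (σ j) j) (x := t) fun j _ => h (σ j) j

/-! ### Compound matrices -/

/-- The vector of all maximal minors of an `n × k` matrix, indexed by the increasing sequences of
row indices (the Plücker coordinates of its column space). -/
noncomputable def minors {n k : ℕ} (X : Matrix (Fin n) (Fin k) ℝ) (α : Fin k ↪o Fin n) : ℝ :=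
  (X.submatrix α id).det

theorem minors_mul {n k : ℕ} (A : Matrix (Fin n) (Fin n) ℝ) (X : Matrix (Fin n) (Fin k) ℝ)
    (α : Fin k ↪o Fin n) :
    minors (A * X) α = ∑ β, multCompound k A α β * minors X β := by
  have h : (A * X).submatrix α id = A.submatrix α id * X := by
    ext i j; simp [Matrix.mul_apply]
  rw [minors, h, det_mul_eq_sum_minors]
  rfl

theorem det_one_submatrix {n k : ℕ} (α β : Fin k ↪o Fin n) :
    ((1 : Matrix (Fin n) (Fin n) ℝ).submatrix α β).det = if α = β then 1 else 0 := by
  split_ifs with h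
  · subst h
    rw [Matrix.submatrix_one _ α.injective, Matrix.det_one]
  · by_cases hs : Set.range α ⊆ Set.range β
    · exact absurd (orderEmb_eq_of_range_subset hs) h
    · obtain ⟨_, ⟨r, rfl⟩, hr⟩ := Set.not_subset.1 hs
      refine Matrix.det_eq_zero_of_row_eq_zero r fun c => ?_
      exact Matrix.one_apply_ne fun hc => hr ⟨c, hc.symm⟩

theorem hasDerivAt_multCompound {n k : ℕ} (A : Matrix (Fin n) (Fin n) ℝ) (α β : Fin k ↪o Fin n) :
    HasDerivAt (fun ε : ℝ => multCompound k (1 + ε • A) α β) (addCompound k A α β) 0 := by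
  have h : ∀ i j, HasDerivAt
      (fun ε : ℝ => ((1 + ε • A : Matrix (Fin n) (Fin n) ℝ).submatrix α β) i j)
      ((A.submatrix α β) i j) 0 := by
    intro i j
    simpa using ((hasDerivAt_id (0 : ℝ)).mul_const (A (α i) (β j))).const_add
      ((1 : Matrix (Fin n) (Fin n) ℝ) (α i) (β j))
  exact (hasDerivAt_det h).differentiableAt.hasDerivAt

/-- Entries of the additive compound: the `(α, β)` entry is the sum of `(-1)^(r+c) A (α r) (β c)`
over the pairs `r, c` such that `α` without its `r`-th term is `β` without its `c`-th term. -/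
theorem addCompound_apply {n k : ℕ} (A : Matrix (Fin n) (Fin n) ℝ) (α β : Fin (k + 1) ↪o Fin n) :
    addCompound (k + 1) A α β = ∑ c : Fin (k + 1), ∑ r : Fin (k + 1),
      (-1) ^ (r + c : ℕ) * A (α r) (β c) *
        if r.succAboveOrderEmb.trans α = c.succAboveOrderEmb.trans β then 1 else 0 := by
  have h : ∀ i j, HasDerivAt
      (fun ε : ℝ => ((1 + ε • A : Matrix (Fin n) (Fin n) ℝ).submatrix α β) i j)
      ((A.submatrix α β) i j) 0 := by
    intro i j
    simpa using ((hasDerivAt_id (0 : ℝ)).mul_const (A (α i) (β j))).const_add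
      ((1 : Matrix (Fin n) (Fin n) ℝ) (α i) (β j))
  refine (hasDerivAt_det h).deriv.trans (Finset.sum_congr rfl fun c _ => ?_)
  rw [Matrix.det_succ_column _ c]
  refine Finset.sum_congr rfl fun r _ => ?_
  rw [Matrix.updateCol_self, Matrix.submatrix_updateCol_succAbove, ← det_one_submatrix]
  simp [Matrix.submatrix_submatrix]
  exact Or.inl rfl

/-- If the columns of `X` solve `ẋ = A x`, then its maximal minors solve `ẇ = A^[k] w`. -/
theorem hasDerivAt_minors {n k : ℕ} {A : Matrix (Fin n) (Fin n) ℝ}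
    {X : ℝ → Matrix (Fin n) (Fin k) ℝ} {t : ℝ}
    (h : ∀ i j, HasDerivAt (fun s => X s i j) ((A * X t) i j) t) (α : Fin k ↪o Fin n) :
    HasDerivAt (fun s => minors (X s) α) (∑ β, addCompound k A α β * minors (X t) β) t := by
  -- `X` and the curve `ε ↦ (1 + ε A) (X t)` have the same tangent, and Cauchy–Binet computes the
  -- minors of the latter.
  have h1 := hasDerivAt_det (M := fun s => (X s).submatrix α id)
    (M' := (A * X t).submatrix α id) (t := t) fun i j => h (α i) j
  have h2 := hasDerivAt_det (M := fun ε : ℝ => ((1 + ε • A) * X t).submatrix α id)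
    (M' := (A * X t).submatrix α id) (t := 0) fun i j => by
      have : ∀ ε : ℝ, ((1 + ε • A) * X t).submatrix α id i j
          = X t (α i) j + ε * (A * X t) (α i) j := by
        intro ε
        rw [Matrix.add_mul, Matrix.one_mul, Matrix.smul_mul]
        rfl
      simp only [this]
      simpa using ((hasDerivAt_id (0 : ℝ)).mul_const ((A * X t) (α i) j)).const_add (X t (α i) j)
  have h3 : HasDerivAt (fun ε : ℝ => minors ((1 + ε • A) * X t) α)
      (∑ β, addCompound k A α β * minors (X t) β) 0 := by
    simp only [minors_mul]
    exact HasDerivAt.fun_sum fun β _ => (hasDerivAt_multCompound A α β).mul_const _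
  have h4 := h2.unique h3
  simp only [zero_smul, add_zero, Matrix.one_mul] at h4
  rw [← h4]
  exact h1

theorem continuousOn_addCompound {n k : ℕ} {A : ℝ → Matrix (Fin n) (Fin n) ℝ} {s : Set ℝ}
    (hA : ContinuousOn A s) (α β : Fin k ↪o Fin n) :
    ContinuousOn (fun t => addCompound k (A t) α β) s := by
  have hA' : ∀ i j, ContinuousOn (fun t => A t i j) s := fun i j => by
    exact (continuous_apply_apply i j).comp_continuousOn hA
  cases k with
  | zero =>
    have : ∀ t, addCompound 0 (A t) α β = 0 := fun t => by
      simp [addCompound, multCompound]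
    simp only [this]
    exact continuousOn_const
  | succ k =>
    simp only [addCompound_apply]
    exact continuousOn_finsetSum _ fun c _ => continuousOn_finsetSum _ fun r _ =>
      (continuousOn_const.mul (hA' _ _)).mul continuousOn_const

/-! ### Sign variations and alternating subsequences -/

/-- `x` has a subsequence of length `m + 1` with strictly alternating signs. The real number `σ`
only carries the sign with which the alternation starts. -/
def Alternates {n : ℕ} (x : Fin n → ℝ) (m : ℕ) : Prop :=
  ∃ (δ : Fin (m + 1) ↪o Fin n) (σ : ℝ), ∀ p : Fin (m + 1), 0 < σ * (-1) ^ (p : ℕ) * x (δ p)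

/-- `x` has a subsequence of length `m + 1` with weakly alternating signs, i.e. one whose zero terms
may be replaced by `1` or `-1` so as to obtain strictly alternating signs. -/
def WeaklyAlternates {n : ℕ} (x : Fin n → ℝ) (m : ℕ) : Prop :=
  ∃ (δ : Fin (m + 1) ↪o Fin n) (σ : ℝ), σ ≠ 0 ∧
    ∀ p : Fin (m + 1), 0 ≤ σ * (-1) ^ (p : ℕ) * x (δ p)

/-- The pairs of consecutive nonzero entries of opposite signs, which `sMinus` counts. -/
def changes {n : ℕ} (x : Fin n → ℝ) : Set (Fin n × Fin n) :=
  {p | p.1 < p.2 ∧ x p.1 * x p.2 < 0 ∧ ∀ l : Fin n, p.1 < l → l < p.2 → x l = 0}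

/-- The number of sign variations among the first `N` entries of `x`. -/
noncomputable def changesBefore {n : ℕ} (x : Fin n → ℝ) (N : ℕ) : ℕ :=
  {p ∈ changes x | (p.2 : ℕ) < N}.ncard

section
variable {n : ℕ} (x : Fin n → ℝ)

theorem changesBefore_zero : changesBefore x 0 = 0 := by
  simp [changesBefore]

theorem changesBefore_self : changesBefore x n = sMinus x := by
  simp [changesBefore, sMinus, changes]

theorem changesBefore_mono : Monotone (changesBefore x) := fun _ _ h =>
  Set.ncard_le_ncard (fun _ hp => ⟨hp.1, hp.2.trans_le h⟩) (Set.toFinite _)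

variable {x}

theorem changes_fst_unique {p p' i : Fin n} (h : (p, i) ∈ changes x) (h' : (p', i) ∈ changes x) :
    p = p' := by
  rcases lt_trichotomy p p' with hl | hl | hl
  · exact absurd h'.2.1 (by simp [h.2.2 p' hl h'.1])
  · exact hl
  · exact absurd h.2.1 (by simp [h'.2.2 p hl h.1])

theorem changesBefore_succ_of_mem {p i : Fin n} (h : (p, i) ∈ changes x) :
    changesBefore x (i + 1) = changesBefore x i + 1 := by
  have : {q ∈ changes x | (q.2 : ℕ) < i + 1} =
      insert (p, i) {q ∈ changes x | (q.2 : ℕ) < i} := by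
    ext ⟨q, j⟩
    simp only [Set.mem_ofPred_eq, Set.mem_insert_iff, Prod.mk.injEq]
    constructor
    · rintro ⟨h1, h2⟩
      rcases Nat.lt_succ_iff_lt_or_eq.1 h2 with h3 | h3
      · exact Or.inr ⟨h1, h3⟩
      · obtain rfl : j = i := Fin.ext h3
        exact Or.inl ⟨changes_fst_unique h1 h, rfl⟩
    · rintro (⟨rfl, rfl⟩ | ⟨h1, h2⟩)
      · exact ⟨h, Nat.lt_succ_self _⟩
      · exact ⟨h1, h2.trans (Nat.lt_succ_self _)⟩
  rw [changesBefore, this, Set.ncard_insert_of_notMem (fun h => lt_irrefl _ h.2) (Set.toFinite _)]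
  rfl

theorem changesBefore_succ_of_notMem {i : Fin n} (h : ∀ p, (p, i) ∉ changes x) :
    changesBefore x (i + 1) = changesBefore x i := by
  refine congrArg Set.ncard (Set.ext ?_)
  rintro ⟨q, j⟩
  simp only [Set.mem_ofPred_eq]
  refine and_congr_right fun hq => ?_
  have : (j : ℕ) ≠ i := fun hj => h q (by rwa [Fin.ext hj] at hq)
  omega

theorem changesBefore_succ_le (i : Fin n) :
    changesBefore x (i + 1) ≤ changesBefore x i + 1 := by
  by_cases h : ∃ p, (p, i) ∈ changes x
  · exact (changesBefore_succ_of_mem h.choose_spec).le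
  · rw [changesBefore_succ_of_notMem (not_exists.1 h)]
    exact Nat.le_succ _

theorem changesBefore_one : changesBefore x 1 = 0 := by
  have : {p ∈ changes x | (p.2 : ℕ) < 1} = ∅ := by
    refine Set.eq_empty_of_forall_notMem ?_
    rintro ⟨p, q⟩ ⟨h1, h2⟩
    have : (p : ℕ) < q := h1.1
    simp only at h2
    omega
  rw [changesBefore, this, Set.ncard_empty]

theorem exists_last_ne_zero (N : ℕ) (hN : N ≤ n) :
    (∀ l : Fin n, (l : ℕ) < N → x l = 0) ∨ ∃ j : Fin n, (j : ℕ) < N ∧ x j ≠ 0 ∧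
      (∀ l : Fin n, j < l → (l : ℕ) < N → x l = 0) ∧
      changesBefore x (j + 1) = changesBefore x N := by
  induction N with
  | zero => exact Or.inl fun l hl => absurd hl (Nat.not_lt_zero _)
  | succ N ih =>
    by_cases h0 : x ⟨N, hN⟩ = 0
    · have hc : changesBefore x (N + 1) = changesBefore x N :=
        changesBefore_succ_of_notMem (i := ⟨N, hN⟩) fun p hp =>
          absurd hp.2.1 (by simp [h0])
      have key : ∀ l : Fin n, (l : ℕ) < N + 1 → ((l : ℕ) < N → x l = 0) → x l = 0 := by
        intro l hl h
        rcases Nat.lt_succ_iff_lt_or_eq.1 hl with h' | h'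
        · exact h h'
        · obtain rfl : l = ⟨N, hN⟩ := Fin.ext h'
          exact h0
      rcases ih (Nat.le_of_succ_le hN) with h | ⟨j, hj, hx, hz, hcj⟩
      · exact Or.inl fun l hl => key l hl (h l)
      · exact Or.inr ⟨j, hj.trans (Nat.lt_succ_self _), hx,
          fun l hjl hl => key l hl (hz l hjl), hcj.trans hc.symm⟩
    · refine Or.inr ⟨⟨N, hN⟩, Nat.lt_succ_self _, h0, fun l hl hl' => ?_, rfl⟩
      have : N < (l : ℕ) := hl
      omega

/-- The parity of the number of sign variations between two nonzero entries tells whether these have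
the same sign. -/
theorem sign_mul_sign_pos : ∀ (N : ℕ) (j : Fin n), (j : ℕ) = N → x j ≠ 0 →
    ∀ i ≤ j, x i ≠ 0 →
      0 < (-1) ^ changesBefore x (i + 1) * x i * ((-1) ^ changesBefore x (j + 1) * x j) := by
  intro N
  induction N using Nat.strong_induction_on with
  | _ N ih =>
    intro j hjN hj i hij hi
    rcases hij.eq_or_lt with rfl | hlt
    · have : (-1 : ℝ) ^ changesBefore x (i + 1) ≠ 0 := pow_ne_zero _ (by norm_num)
      exact mul_self_pos.2 (mul_ne_zero this hi)
    · rcases exists_last_ne_zero (x := x) j j.2.le with h | ⟨j', hj', hx, hz, hc⟩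
      · exact absurd (h i hlt) hi
      · have hij' : i ≤ j' := by
          by_contra hcon
          exact hi (hz i (not_le.1 hcon) hlt)
        have hpos := ih j' (hjN ▸ hj') j' rfl hx i hij' hi
        set s := (-1 : ℝ) ^ changesBefore x (i + 1) * x i with hs
        rcases lt_or_ge (x j' * x j) 0 with hneg | hnn
        · rw [changesBefore_succ_of_mem (p := j') ⟨hj', hneg, hz⟩, ← hc, pow_succ]
          set e := (-1 : ℝ) ^ changesBefore x (j' + 1)
          have h1 : 0 < (s * (e * x j')) * (-(x j' * x j)) := mul_pos hpos (by linarith)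
          have h2 : (s * (e * x j')) * (-(x j' * x j)) = s * (e * -1 * x j) * (x j' * x j') := by
            ring
          rw [h2] at h1
          exact pos_of_mul_pos_left h1 (mul_self_nonneg _)
        · rw [changesBefore_succ_of_notMem, ← hc]
          · set e := (-1 : ℝ) ^ changesBefore x (j' + 1)
            have h1 : 0 < (s * (e * x j')) * (x j' * x j) :=
              mul_pos hpos (hnn.lt_of_ne (mul_ne_zero hx hj).symm)
            have h2 : (s * (e * x j')) * (x j' * x j) = s * (e * x j) * (x j' * x j') := by ring
            rw [h2] at h1
            exact pos_of_mul_pos_left h1 (mul_self_nonneg _)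
          · intro p hp
            rcases lt_trichotomy p j' with hl | rfl | hl
            · exact hx (hp.2.2 j' hl hj')
            · exact absurd hp.2.1 (not_lt.2 hnn)
            · exact absurd hp.2.1 (by simp [hz p hl hp.1])

theorem exists_change {v : ℕ} (h : v < sMinus x) :
    ∃ p i : Fin n, (p, i) ∈ changes x ∧ changesBefore x i = v := by
  classical
  have hex : ∃ N, v < changesBefore x N := ⟨n, by rwa [changesBefore_self]⟩
  obtain ⟨N, hN⟩ : ∃ N, Nat.find hex = N + 1 := by
    refine Nat.exists_eq_succ_of_ne_zero fun h0 => ?_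
    have := Nat.find_spec hex
    rw [h0, changesBefore_zero] at this
    exact Nat.not_lt_zero _ this
  have h1 : v < changesBefore x (N + 1) := hN ▸ Nat.find_spec hex
  have h2 : changesBefore x N ≤ v :=
    not_lt.1 (Nat.find_min hex (by omega : N < Nat.find hex))
  have h3 : N < n := by
    have := Nat.find_min' hex (m := n) (by rwa [changesBefore_self])
    omega
  by_cases hp : ∃ p, (p, ⟨N, h3⟩) ∈ changes x
  · obtain ⟨p, hp⟩ := hp
    have h4 : changesBefore x (N + 1) = changesBefore x N + 1 := changesBefore_succ_of_mem hp
    refine ⟨p, _, hp, ?_⟩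
    simp only
    omega
  · have h4 : changesBefore x (N + 1) = changesBefore x N :=
      changesBefore_succ_of_notMem (i := ⟨N, h3⟩) (not_exists.1 hp)
    omega

theorem exists_ne_zero_changesBefore_eq {v : ℕ} (hs : 0 < sMinus x) (h : v ≤ sMinus x) :
    ∃ i : Fin n, x i ≠ 0 ∧ changesBefore x (i + 1) = v := by
  cases v with
  | zero =>
    obtain ⟨p, i, hpi, hi⟩ := exists_change hs
    refine ⟨p, left_ne_zero_of_mul hpi.2.1.ne, Nat.le_zero.1 ?_⟩
    rw [← hi]
    exact changesBefore_mono x (Nat.succ_le_of_lt hpi.1)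
  | succ v =>
    obtain ⟨p, i, hpi, hi⟩ := exists_change h
    exact ⟨i, right_ne_zero_of_mul hpi.2.1.ne, by rw [changesBefore_succ_of_mem hpi, hi]⟩

theorem le_sMinus_iff_alternates {m : ℕ} : m + 1 ≤ sMinus x ↔ Alternates x (m + 1) := by
  constructor
  · intro h
    have hex : ∀ v : Fin (m + 2), ∃ i : Fin n, x i ≠ 0 ∧ changesBefore x (i + 1) = v :=
      fun v => exists_ne_zero_changesBefore_eq (by omega) (by omega)
    choose δ hx hc using hex
    have hmono : StrictMono δ := by
      intro v w hvw
      by_contra hcon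
      have := changesBefore_mono x (Nat.succ_le_succ (not_lt.1 hcon : (δ w : ℕ) ≤ δ v))
      simp only [Nat.succ_eq_add_one, hc] at this
      exact absurd hvw (not_lt.2 this)
    refine ⟨OrderEmbedding.ofStrictMono δ hmono, x (δ 0), fun p => ?_⟩
    have := sign_mul_sign_pos _ (δ p) rfl (hx p) (δ 0) (hmono.monotone (Fin.zero_le _)) (hx 0)
    rw [hc, hc] at this
    simpa [mul_assoc] using this
  · rintro ⟨δ, σ, h⟩
    have key : ∀ v : ℕ, ∀ hv : v < m + 2, v ≤ changesBefore x (δ ⟨v, hv⟩ + 1) := by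
      intro v
      induction v with
      | zero => exact fun _ => Nat.zero_le _
      | succ v ih =>
        intro hv
        have h0 := ih (by omega)
        have hlt : δ ⟨v, by omega⟩ < δ ⟨v + 1, hv⟩ := δ.strictMono (Nat.lt_succ_self v)
        have h1 := h ⟨v, by omega⟩
        have h2 := h ⟨v + 1, hv⟩
        have hmon := changesBefore_mono x (Nat.succ_le_succ hlt.le)
        simp only [Nat.succ_eq_add_one] at hmon
        refine Nat.succ_le_of_lt (h0.trans_lt (hmon.lt_of_ne fun heq => ?_))
        have h3 := sign_mul_sign_pos _ _ rfl (right_ne_zero_of_mul h2.ne') _ hlt.le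
          (right_ne_zero_of_mul h1.ne')
        rw [heq] at h3
        have h4 := mul_pos h1 h2
        simp only [pow_succ] at h4
        have h5 := mul_pos h3 h4
        have h6 : ∀ e f u w s : ℝ, e * u * (e * w) * (s * f * u * (s * (f * -1) * w)) =
          -(e * u * w * s * f) ^ 2 := by intros; ring
        rw [h6] at h5
        exact absurd h5 (not_lt.2 (neg_nonpos.2 (sq_nonneg _)))
    refine (key (m + 1) (by omega)).trans ?_
    rw [← changesBefore_self x]
    exact changesBefore_mono x (Fin.is_lt _)

theorem mem_PMinus_iff {k : ℕ} : x ∈ PMinus n (k + 1) ↔ ¬ Alternates x (k + 1) := by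
  rw [← le_sMinus_iff_alternates, not_le, Nat.lt_succ_iff]
  rfl

theorem mem_PPlus_iff {k : ℕ} : x ∈ PPlus n (k + 1) ↔ ¬ WeaklyAlternates x (k + 1) := by
  classical
  have h1 : x ∈ PPlus n (k + 1) ↔ ∀ ε : Fin n → ℤˣ,
      ¬ Alternates (fun i => if x i = 0 then ((ε i : ℤ) : ℝ) else x i) (k + 1) := by
    simp only [← le_sMinus_iff_alternates, not_le, Nat.lt_succ_iff]
    change sPlus x ≤ k ↔ _
    simp [sPlus]
  rw [h1, ← not_exists, not_iff_not]
  constructor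
  · rintro ⟨ε, δ, σ, h⟩
    refine ⟨δ, σ, fun h0 => by simpa [h0] using h 0, fun p => ?_⟩
    have := h p
    by_cases hx : x (δ p) = 0
    · simp [hx]
    · simpa [hx] using this.le
  · rintro ⟨δ, σ, hσ, h⟩
    let s : ℤˣ := if 0 < σ then 1 else -1
    have hs : 0 < σ * ((s : ℤ) : ℝ) := by
      by_cases h0 : 0 < σ
      · simp [s, h0]
      · simp only [s, h0, if_false]
        have : σ < 0 := lt_of_le_of_ne (not_lt.1 h0) hσ
        simpa using this
    refine ⟨Function.extend δ (fun p => s * (-1) ^ (p : ℕ)) 1, δ, σ, fun p => ?_⟩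
    simp only
    rw [δ.injective.extend_apply]
    split_ifs with hx
    · have h2 : ((-1 : ℝ) ^ (p : ℕ)) * (-1) ^ (p : ℕ) = 1 := by
        rw [← mul_pow]; norm_num
      push_cast
      have : σ * (-1 : ℝ) ^ (p : ℕ) * (((s : ℤ) : ℝ) * (-1) ^ (p : ℕ)) =
        σ * ((s : ℤ) : ℝ) * ((-1 : ℝ) ^ (p : ℕ) * (-1) ^ (p : ℕ)) := by ring
      rw [this, h2, mul_one]
      exact hs
    · exact (h p).lt_of_ne
        (mul_ne_zero (mul_ne_zero hσ (pow_ne_zero _ (by norm_num))) hx).symm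

theorem Alternates.weaklyAlternates {m : ℕ} (h : Alternates x m) : WeaklyAlternates x m := by
  obtain ⟨δ, σ, h⟩ := h
  exact ⟨δ, σ, fun h0 => by simpa [h0] using h 0, fun p => (h p).le⟩

theorem PPlus_subset_PMinus (k : ℕ) : PPlus n (k + 1) ⊆ PMinus n (k + 1) := fun _ hx =>
  mem_PMinus_iff.2 fun h => mem_PPlus_iff.1 hx h.weaklyAlternates

theorem isClosed_PMinus (k : ℕ) : IsClosed (PMinus n (k + 1)) := by
  have : (PMinus n (k + 1))ᶜ = ⋃ (δ : Fin (k + 1 + 1) ↪o Fin n) (σ : ℝ),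
      ⋂ p : Fin (k + 1 + 1), {x | 0 < σ * (-1) ^ (p : ℕ) * x (δ p)} := by
    ext x
    rw [Set.mem_compl_iff, mem_PMinus_iff, not_not]
    simp [Alternates]
  rw [← isOpen_compl_iff, this]
  refine isOpen_iUnion fun δ => isOpen_iUnion fun σ => isOpen_iInter_of_finite fun p => ?_
  exact isOpen_lt continuous_const (continuous_const.mul (continuous_apply _))

theorem mem_PMinus_of_support {k : ℕ} (β : Fin (k + 1) ↪o Fin n)
    (h : ∀ i, i ∉ Set.range β → x i = 0) : x ∈ PMinus n (k + 1) := by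
  refine mem_PMinus_iff.2 ?_
  rintro ⟨δ, σ, hδ⟩
  have h1 : Set.range δ ⊆ Set.range β := by
    rintro _ ⟨p, rfl⟩
    by_contra hp
    exact absurd (hδ p) (by simp [h _ hp])
  have h2 := Set.ncard_le_ncard h1 (Set.toFinite _)
  rw [← Set.image_univ, ← Set.image_univ, Set.ncard_image_of_injective _ δ.injective,
    Set.ncard_image_of_injective _ β.injective] at h2
  simp [Set.ncard_univ] at h2

/-- A vector with at most `k` sign variations can be cut into `k + 1` nonempty consecutive blocks,
each without entries of opposite signs. -/
theorem exists_blocks {k : ℕ} (hkn : k + 1 ≤ n) (hx : x ∈ PMinus n (k + 1)) :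
    ∃ b : Fin n → Fin (k + 1), Monotone b ∧ Function.Surjective b ∧
      ∀ i j, b i = b j → 0 ≤ x i * x j := by
  classical
  have hx' : changesBefore x n ≤ k := by rw [changesBefore_self]; exact hx
  -- Cutting at the sign variations may give too few blocks; the second term of the maximum makes
  -- blocks of length one out of the last entries.
  let f : ℕ → ℕ := fun N => max (changesBefore x (N + 1)) (N + (k + 1) - n)
  have hf : Monotone f := fun M N h =>
    max_le_max (changesBefore_mono x (Nat.succ_le_succ h)) (by omega)
  have hfk : ∀ i : Fin n, f i < k + 1 := fun i => by
    have := changesBefore_mono x (Nat.succ_le_of_lt i.2)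
    simp only [f, Nat.succ_eq_add_one] at this ⊢
    omega
  have hf0 : f 0 = 0 := by
    simp only [f, zero_add, changesBefore_one]
    omega
  have hfs : ∀ N, N + 1 < n → f (N + 1) ≤ f N + 1 := fun N hN => by
    have := changesBefore_succ_le (x := x) ⟨N + 1, hN⟩
    simp only [f] at this ⊢
    omega
  refine ⟨fun i => ⟨f i, hfk i⟩, fun i j hij => hf hij, fun v => ?_, ?_⟩
  · have hlast : (v : ℕ) ≤ f (n - 1) := by
      have : k ≤ f (n - 1) := le_max_of_le_right (by omega)
      omega
    have hex : ∃ N, (v : ℕ) ≤ f N := ⟨n - 1, hlast⟩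
    have hlt : Nat.find hex < n := by
      have := Nat.find_min' hex hlast
      omega
    refine ⟨⟨Nat.find hex, hlt⟩, Fin.ext ?_⟩
    have hspec := Nat.find_spec hex
    refine le_antisymm ?_ hspec
    change f (Nat.find hex) ≤ v
    rcases Nat.eq_zero_or_eq_succ_pred (Nat.find hex) with h0 | hN
    · rw [h0, hf0]; exact Nat.zero_le _
    · have h1 := Nat.find_min hex (m := (Nat.find hex).pred) (by omega)
      have h2 := hfs (Nat.find hex).pred (by omega)
      rw [← Nat.succ_eq_add_one, ← hN] at h2
      omega
  · have key : ∀ i j : Fin n, i ≤ j → f i = f j → 0 ≤ x i * x j := by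
      intro i j hij h
      rcases hij.eq_or_lt with rfl | hlt
      · exact mul_self_nonneg _
      · have hc : changesBefore x (i + 1) = changesBefore x (j + 1) := by
          have h1 := changesBefore_mono x (Nat.succ_le_succ hij)
          have h2 : (i : ℕ) < j := hlt
          simp only [f, Nat.succ_eq_add_one] at h h1
          omega
        by_cases hi : x i = 0
        · simp [hi]
        by_cases hj : x j = 0
        · simp [hj]
        have := sign_mul_sign_pos _ j rfl hj i hij hi
        rw [hc, mul_mul_mul_comm, ← mul_pow] at this
        simpa using this.le
    intro i j h
    have h : f i = f j := congrArg Fin.val h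
    rcases le_total i j with hij | hij
    · exact key i j hij h
    · rw [mul_comm]
      exact key j i hij h.symm

end

/-! ### Linear differential inequalities -/

section
variable {ι : Type*} [Fintype ι] {s t : ℝ}

theorem le_mul_exp_of_deriv_le {h h' : ℝ → ℝ} {K : ℝ} (hst : s ≤ t)
    (hc : ContinuousOn h (Icc s t)) (hd : ∀ τ ∈ Ioo s t, HasDerivAt h (h' τ) τ)
    (hle : ∀ τ ∈ Ioo s t, h' τ ≤ K * h τ) : h t ≤ Real.exp (K * (t - s)) * h s := by
  have hanti : AntitoneOn (fun τ => Real.exp (-(K * (τ - s))) * h τ) (Icc s t) := by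
    have hexp : ∀ τ : ℝ, HasDerivAt (fun τ => Real.exp (-(K * (τ - s))))
        (Real.exp (-(K * (τ - s))) * -K) τ := fun τ => by
      simpa using ((((hasDerivAt_id τ).sub_const s).const_mul K).neg).exp
    refine antitoneOn_of_deriv_nonpos (convex_Icc s t)
      ((Continuous.continuousOn (by fun_prop)).mul hc) ?_ ?_
    · rw [interior_Icc]
      exact fun τ hτ => ((hexp τ).mul (hd τ hτ)).differentiableAt.differentiableWithinAt
    · rw [interior_Icc]
      intro τ hτ
      rw [((hexp τ).fun_mul (hd τ hτ)).deriv]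
      have := mul_nonneg (Real.exp_pos (-(K * (τ - s)))).le (sub_nonneg.2 (hle τ hτ))
      linarith
  have := hanti (left_mem_Icc.2 hst) (right_mem_Icc.2 hst) hst
  simp only [sub_self, mul_zero, neg_zero, Real.exp_zero, one_mul, Real.exp_neg] at this
  rwa [inv_mul_le_iff₀ (Real.exp_pos _)] at this

theorem le_exp_mul_of_neg_le_deriv {h h' : ℝ → ℝ} {K : ℝ} (hst : s ≤ t)
    (hc : ContinuousOn h (Icc s t)) (hd : ∀ τ ∈ Ioo s t, HasDerivAt h (h' τ) τ)
    (hle : ∀ τ ∈ Ioo s t, -(K * h τ) ≤ h' τ) : h s ≤ Real.exp (K * (t - s)) * h t := by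
  have := le_mul_exp_of_deriv_le (h := fun τ => - h τ) (h' := fun τ => - h' τ) (K := -K) hst
    hc.neg (fun τ hτ => (hd τ hτ).fun_neg) (fun τ hτ => by have := hle τ hτ; linarith)
  rw [neg_mul, Real.exp_neg, mul_neg, neg_le_neg_iff, inv_mul_le_iff₀ (Real.exp_pos _)] at this
  exact this

/-- An energy estimate: `∑ uᵢ²` vanishes on `[s, t]` if it does at `s` and its derivative
`2 ∑ uᵢ Mᵢⱼ wⱼ` is bounded by a multiple of `∑ uᵢ²`, term by term. -/
theorem eq_zero_of_energy_estimate {u w : ℝ → ι → ℝ} {M : ℝ → Matrix ι ι ℝ} {C : ℝ} (hst : s ≤ t)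
    (hc : ∀ i, ContinuousOn (fun τ => u τ i) (Icc s t))
    (hd : ∀ τ ∈ Ioo s t, ∀ i,
      HasDerivAt (fun τ => u τ i ^ 2) (2 * u τ i * ∑ j, M τ i j * w τ j) τ)
    (hle : ∀ τ ∈ Ioo s t, ∀ i j, u τ i * (M τ i j * w τ j) ≤ C * (u τ i ^ 2 + u τ j ^ 2))
    (h0 : u s = 0) : u t = 0 := by
  have key := le_mul_exp_of_deriv_le (h := fun τ => ∑ i, u τ i ^ 2)
    (h' := fun τ => ∑ i, 2 * u τ i * ∑ j, M τ i j * w τ j) (K := 4 * C * Fintype.card ι) hst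
    (continuousOn_finsetSum _ fun i _ => (hc i).pow 2)
    (fun τ hτ => HasDerivAt.fun_sum fun i _ => hd τ hτ i) (fun τ hτ => by
      calc ∑ i, 2 * u τ i * ∑ j, M τ i j * w τ j
          = ∑ i, ∑ j, 2 * (u τ i * (M τ i j * w τ j)) := by
            simp only [Finset.mul_sum, mul_assoc]
        _ ≤ ∑ i, ∑ j, 2 * (C * (u τ i ^ 2 + u τ j ^ 2)) :=
            Finset.sum_le_sum fun i _ => Finset.sum_le_sum fun j _ => by
              linarith [hle τ hτ i j]
        _ = 4 * C * Fintype.card ι * ∑ i, u τ i ^ 2 := by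
            simp only [mul_add, Finset.sum_add_distrib, Finset.sum_const, ← Finset.mul_sum,
              Finset.card_univ, nsmul_eq_mul]
            ring)
  have hs : ∑ i, u s i ^ 2 = 0 := by simp [h0]
  simp only [hs, mul_zero] at key
  have := (Finset.sum_eq_zero_iff_of_nonneg (fun i _ => sq_nonneg (u t i))).1
    (key.antisymm (Finset.sum_nonneg fun i _ => sq_nonneg _))
  exact funext fun i => pow_eq_zero_iff (two_ne_zero) |>.1 (this i (Finset.mem_univ i))

theorem mul_mul_le_of_abs_le {C m x y : ℝ} (hm : |m| ≤ C) :
    x * (m * y) ≤ C * (x ^ 2 + y ^ 2) := by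
  have hC : 0 ≤ C := (abs_nonneg m).trans hm
  have h1 : x * (m * y) ≤ C * (|x| * |y|) :=
    calc x * (m * y) ≤ |x * (m * y)| := le_abs_self _
      _ = |m| * (|x| * |y|) := by rw [abs_mul, abs_mul]; ring
      _ ≤ C * (|x| * |y|) := by gcongr
  refine h1.trans (mul_le_mul_of_nonneg_left ?_ hC)
  rw [← sq_abs x, ← sq_abs y]
  nlinarith [sq_nonneg (|x| - |y|), sq_nonneg |x|, sq_nonneg |y|]

/-- The coordinates in `S` stay zero if they do not depend on those outside `S`. -/
theorem eq_zero_of_block_triangular {w : ℝ → ι → ℝ} {M : ℝ → Matrix ι ι ℝ} {C : ℝ} {S : Set ι}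
    (hst : s ≤ t) (hc : ∀ i, ContinuousOn (fun τ => w τ i) (Icc s t))
    (hd : ∀ τ ∈ Ioo s t, ∀ i, HasDerivAt (fun τ => w τ i) (∑ j, M τ i j * w τ j) τ)
    (hC : ∀ τ ∈ Ioo s t, ∀ i j, |M τ i j| ≤ C)
    (hS : ∀ τ ∈ Ioo s t, ∀ i ∈ S, ∀ j ∈ Sᶜ, M τ i j = 0)
    (h0 : ∀ i ∈ S, w s i = 0) : ∀ i ∈ S, w t i = 0 := by
  classical
  have key := eq_zero_of_energy_estimate (u := fun τ i => if i ∈ S then w τ i else 0) (w := w)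
    (M := M) (C := C) hst ?_ ?_ ?_ ?_
  · intro i hi
    simpa [hi] using congrFun key i
  · intro i
    by_cases hi : i ∈ S
    · simpa [hi] using hc i
    · simpa [hi] using continuousOn_const
  · intro τ hτ i
    by_cases hi : i ∈ S
    · simpa [hi] using (hd τ hτ i).fun_pow 2
    · simpa [hi] using hasDerivAt_const τ (0 : ℝ)
  · intro τ hτ i j
    have hC0 : 0 ≤ C := (abs_nonneg _).trans (hC τ hτ i j)
    by_cases hi : i ∈ S
    · by_cases hj : j ∈ S
      · simpa [hi, hj] using mul_mul_le_of_abs_le (hC τ hτ i j)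
      · simpa [hi, hj, hS τ hτ i hi j hj] using mul_nonneg hC0 (sq_nonneg (w τ i))
    · simp only [hi, if_false, zero_mul]
      positivity
  · ext i
    by_cases hi : i ∈ S
    · simp [hi, h0 i hi]
    · simp [hi]

theorem hasDerivAt_min_zero_sq (x : ℝ) : HasDerivAt (fun y : ℝ => min y 0 ^ 2) (2 * min x 0) x := by
  rcases lt_trichotomy x 0 with hx | rfl | hx
  · rw [min_eq_left hx.le]
    refine HasDerivAt.congr_of_eventuallyEq (by simpa using hasDerivAt_pow 2 x) ?_
    filter_upwards [gt_mem_nhds hx] with y hy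
    rw [min_eq_left hy.le]
  · rw [hasDerivAt_iff_tendsto_slope]
    have h : Tendsto (fun y : ℝ => min y 0) (𝓝[≠] 0) (𝓝 (2 * min 0 0)) := by
      have h1 : Continuous fun y : ℝ => min y 0 := by fun_prop
      simpa using (h1.tendsto 0).mono_left nhdsWithin_le_nhds
    refine h.congr' ?_
    filter_upwards [self_mem_nhdsWithin] with y hy
    rw [slope_def_field]
    rcases le_total y 0 with h | h
    · have : y ≠ 0 := hy
      simp only [min_eq_left h, min_self, sub_zero]
      field_simp
      simp
    · simp [min_eq_right h]
  · rw [min_eq_right hx.le, mul_zero]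
    refine (hasDerivAt_const x (0 : ℝ)).congr_of_eventuallyEq ?_
    filter_upwards [lt_mem_nhds hx] with y hy
    simp [min_eq_right hy.le]

/-- A linear system with Metzler matrices preserves the nonnegative orthant. -/
theorem nonneg_of_isMetzler {w : ℝ → ι → ℝ} {M : ℝ → Matrix ι ι ℝ} {C : ℝ}
    (hst : s ≤ t) (hc : ∀ i, ContinuousOn (fun τ => w τ i) (Icc s t))
    (hd : ∀ τ ∈ Ioo s t, ∀ i, HasDerivAt (fun τ => w τ i) (∑ j, M τ i j * w τ j) τ)
    (hC : ∀ τ ∈ Ioo s t, ∀ i j, |M τ i j| ≤ C)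
    (hM : ∀ τ ∈ Ioo s t, IsMetzler (M τ))
    (h0 : ∀ i, 0 ≤ w s i) (i : ι) : 0 ≤ w t i := by
  have key := eq_zero_of_energy_estimate (u := fun τ i => min (w τ i) 0) (w := w)
    (M := M) (C := C) hst (fun i => (hc i).inf continuousOn_const) ?_ ?_ ?_
  · exact min_eq_right_iff.1 (congrFun key i)
  · exact fun τ hτ i =>
      HasDerivAt.comp (h₂ := fun y : ℝ => min y 0 ^ 2) τ (hasDerivAt_min_zero_sq (w τ i))
        (hd τ hτ i)
  · intro τ hτ i j
    by_cases hij : i = j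
    · subst hij
      refine le_trans (le_of_eq ?_) (mul_mul_le_of_abs_le (hC τ hτ i i))
      rcases le_total (w τ i) 0 with h | h <;> simp [h]
    · refine le_trans ?_ (mul_mul_le_of_abs_le (hC τ hτ i j))
      exact mul_le_mul_of_nonpos_left
        (mul_le_mul_of_nonneg_left (min_le_left _ _) (hM τ hτ i j hij)) (min_le_right _ _)
  · exact funext fun i => min_eq_right (h0 i)

/-- In a nonnegative solution of a system with Metzler matrices, positive coordinates stay
positive. -/
theorem pos_of_isMetzler {w : ℝ → ι → ℝ} {M : ℝ → Matrix ι ι ℝ} {C : ℝ}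
    (hst : s ≤ t) (hc : ∀ i, ContinuousOn (fun τ => w τ i) (Icc s t))
    (hd : ∀ τ ∈ Ioo s t, ∀ i, HasDerivAt (fun τ => w τ i) (∑ j, M τ i j * w τ j) τ)
    (hC : ∀ τ ∈ Ioo s t, ∀ i j, |M τ i j| ≤ C)
    (hM : ∀ τ ∈ Ioo s t, IsMetzler (M τ))
    (h0 : ∀ τ ∈ Ioo s t, ∀ i, 0 ≤ w τ i) {i : ι} (hi : 0 < w s i) : 0 < w t i := by
  classical
  have key := le_exp_mul_of_neg_le_deriv (K := C) hst (hc i) (fun τ hτ => hd τ hτ i)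
    (fun τ hτ => by
      rw [← Finset.add_sum_erase _ _ (Finset.mem_univ i)]
      have h1 : 0 ≤ ∑ j ∈ Finset.univ.erase i, M τ i j * w τ j :=
        Finset.sum_nonneg fun j hj =>
          mul_nonneg (hM τ hτ i j (Finset.ne_of_mem_erase hj).symm) (h0 τ hτ j)
      have h2 := mul_le_mul_of_nonneg_right (neg_le_of_abs_le (hC τ hτ i i)) (h0 τ hτ i)
      linarith)
  exact pos_of_mul_pos_right (hi.trans_le key) (Real.exp_pos _).le

/-- A linear system with Metzler matrices that are irreducible at times arbitrarily close after the
initial time `s` maps the nonnegative orthant without the origin into its interior. -/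
theorem pos_of_isIrreducibleMatrix {w : ℝ → ι → ℝ} {M : ℝ → Matrix ι ι ℝ} {C : ℝ}
    (hst : s < t) (hc : ∀ i, ContinuousOn (fun τ => w τ i) (Icc s t))
    (hd : ∀ τ ∈ Ioo s t, ∀ i, HasDerivAt (fun τ => w τ i) (∑ j, M τ i j * w τ j) τ)
    (hC : ∀ τ ∈ Ioo s t, ∀ i j, |M τ i j| ≤ C)
    (hM : ∀ τ ∈ Ioo s t, IsMetzler (M τ))
    (hirr : ∀ r ∈ Ioo s t, ∃ τ ∈ Ioo s r, IsIrreducibleMatrix (M τ))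
    (h0 : ∀ i, 0 ≤ w s i) {i₀ : ι} (hi₀ : 0 < w s i₀) (i : ι) : 0 < w t i := by
  classical
  have hnn : ∀ τ ∈ Icc s t, ∀ i, 0 ≤ w τ i := fun τ hτ =>
    nonneg_of_isMetzler hτ.1 (fun i => (hc i).mono (Icc_subset_Icc_right hτ.2))
      (fun τ' h => hd τ' (Ioo_subset_Ioo_right hτ.2 h))
      (fun τ' h => hC τ' (Ioo_subset_Ioo_right hτ.2 h))
      (fun τ' h => hM τ' (Ioo_subset_Ioo_right hτ.2 h)) h0
  have hpersist : ∀ τ₁ τ₂, s ≤ τ₁ → τ₁ ≤ τ₂ → τ₂ ≤ t → ∀ i, 0 < w τ₁ i → 0 < w τ₂ i :=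
    fun τ₁ τ₂ h1 h12 h2 i hi =>
      have hsub : Ioo τ₁ τ₂ ⊆ Ioo s t := Ioo_subset_Ioo h1 h2
      pos_of_isMetzler h12 (fun i => (hc i).mono (Icc_subset_Icc h1 h2))
        (fun τ h => hd τ (hsub h)) (fun τ h => hC τ (hsub h)) (fun τ h => hM τ (hsub h))
        (fun τ h => hnn τ (Ioo_subset_Icc_self (hsub h))) hi
  -- The set of vanishing coordinates shrinks with time. Take a time `r` after `s` at which it is
  -- as large as possible: it is then constant on `(s, r]`.
  let Z : ℝ → Finset ι := fun τ => Finset.univ.filter fun i => w τ i = 0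
  obtain ⟨r, hr, hmax⟩ : ∃ r ∈ Ioo s t, ∀ τ ∈ Ioo s t, (Z τ).card ≤ (Z r).card := by
    have hfin : ((fun τ => (Z τ).card) '' Ioo s t).Finite :=
      (Set.finite_Iic (Fintype.card ι)).subset (by
        rintro _ ⟨τ, -, rfl⟩; exact Finset.card_le_univ _)
    obtain ⟨r, hr, h⟩ := Set.exists_max_image _ id hfin ((nonempty_Ioo.2 hst).image _)
    obtain ⟨r, hr', rfl⟩ := hr
    exact ⟨r, hr', fun τ hτ => h _ ⟨τ, hτ, rfl⟩⟩
  have hZ : ∀ τ ∈ Ioo s r, Z τ = Z r := fun τ hτ => by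
    have hτ' : τ ∈ Ioo s t := ⟨hτ.1, hτ.2.trans hr.2⟩
    refine (Finset.eq_of_subset_of_card_le (fun i hi => ?_) (hmax τ hτ')).symm
    simp only [Z, Finset.mem_filter, Finset.mem_univ, true_and] at hi ⊢
    by_contra hne
    have h1 : 0 < w τ i := (hnn τ (Ioo_subset_Icc_self hτ') i).lt_of_ne (Ne.symm hne)
    exact (hpersist τ r hτ.1.le hτ.2.le hr.2.le i h1).ne' hi
  by_contra hcon
  have hit : w t i = 0 := le_antisymm (not_lt.1 hcon) (hnn t (right_mem_Icc.2 hst.le) i)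
  have hir : w r i = 0 := by
    by_contra hne
    have h1 : 0 < w r i := (hnn r (Ioo_subset_Icc_self hr) i).lt_of_ne (Ne.symm hne)
    exact (hpersist r t hr.1.le hr.2.le le_rfl i h1).ne' hit
  have hi₀r : w r i₀ ≠ 0 := (hpersist s r le_rfl hr.1.le hr.2.le i₀ hi₀).ne'
  obtain ⟨τ, hτ, hirrτ⟩ := hirr r hr
  have hτ' : τ ∈ Ioo s t := ⟨hτ.1, hτ.2.trans hr.2⟩
  obtain ⟨j, hj, l, hl, hne⟩ := hirrτ {j | w r j = 0} ⟨i, hir⟩ ⟨i₀, hi₀r⟩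
  have hmem : ∀ τ' ∈ Ioo s r, ∀ j, w τ' j = 0 ↔ w r j = 0 := fun τ' h j => by
    have := Finset.ext_iff.1 (hZ τ' h) j
    simpa [Z] using this
  have hder : ∑ l, M τ j l * w τ l = 0 := by
    refine (hd τ hτ' j).unique ((hasDerivAt_const τ (0 : ℝ)).congr_of_eventuallyEq ?_)
    filter_upwards [Ioo_mem_nhds hτ.1 hτ.2] with τ' h
    exact (hmem τ' h j).2 hj
  have hterm : ∀ l ∈ Finset.univ, 0 ≤ M τ j l * w τ l := fun l _ => by
    by_cases hjl : j = l
    · subst hjl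
      rw [(hmem τ hτ j).2 hj, mul_zero]
    · exact mul_nonneg (hM τ hτ' j l hjl) (hnn τ (Ioo_subset_Icc_self hτ') l)
  have := (Finset.sum_eq_zero_iff_of_nonneg hterm).1 hder l (Finset.mem_univ l)
  exact (mul_ne_zero hne fun h => hl ((hmem τ hτ l).1 h)) this

end

/-! ### Solutions of linear systems -/

theorem exists_bound_of_continuousOn {ι : Type*} [Finite ι] {M : ℝ → Matrix ι ι ℝ} {a b : ℝ}
    (hM : ∀ i j, ContinuousOn (fun t => M t i j) (Icc a b)) :
    ∃ C, ∀ t ∈ Icc a b, ∀ i j, |M t i j| ≤ C := by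
  cases nonempty_fintype ι
  have h : ∀ i j, ∃ C, ∀ t ∈ Icc a b, |M t i j| ≤ C := fun i j =>
    isCompact_Icc.exists_bound_of_continuousOn (hM i j)
  choose C hC using h
  refine ⟨∑ i, ∑ j, |C i j|, fun t ht i j => (hC i j t ht).trans ((le_abs_self _).trans ?_)⟩
  have h1 : |C i j| ≤ ∑ j, |C i j| :=
    Finset.single_le_sum (f := fun j => |C i j|) (fun _ _ => abs_nonneg _) (Finset.mem_univ j)
  exact h1.trans (Finset.single_le_sum (f := fun i => ∑ j, |C i j|)
    (fun _ _ => Finset.sum_nonneg fun _ _ => abs_nonneg _) (Finset.mem_univ i))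

section
variable {n : ℕ} {A : ℝ → Matrix (Fin n) (Fin n) ℝ} {a b : ℝ}

theorem exists_bound_entries (hA : ContinuousOn A (Icc a b)) :
    ∃ C, ∀ t ∈ Icc a b, ∀ i j, |A t i j| ≤ C :=
  exists_bound_of_continuousOn fun i j => (continuous_apply_apply i j).comp_continuousOn hA

theorem norm_mulVec_le {B : Matrix (Fin n) (Fin n) ℝ} {C : ℝ} (hC0 : 0 ≤ C)
    (hB : ∀ i j, |B i j| ≤ C) (v : Fin n → ℝ) : ‖B.mulVec v‖ ≤ n * C * ‖v‖ := by
  refine (pi_norm_le_iff_of_nonneg (by positivity)).2 fun i => ?_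
  calc ‖∑ j, B i j * v j‖ ≤ ∑ j, ‖B i j * v j‖ := norm_sum_le _ _
    _ ≤ ∑ _j : Fin n, C * ‖v‖ := Finset.sum_le_sum fun j _ => by
        rw [norm_mul]
        exact mul_le_mul (hB i j) (norm_le_pi_norm v j) (norm_nonneg _) hC0
    _ = n * C * ‖v‖ := by simp [mul_assoc]

/-- Truncation of all coordinates to `[-R, R]`. -/
def clamp {n : ℕ} (R : ℝ) (v : Fin n → ℝ) : Fin n → ℝ := fun i => max (-R) (min (v i) R)

theorem norm_clamp_sub_clamp_le (R : ℝ) (v w : Fin n → ℝ) :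
    ‖clamp R v - clamp R w‖ ≤ ‖v - w‖ := by
  refine (pi_norm_le_iff_of_nonneg (norm_nonneg _)).2 fun i => ?_
  refine le_trans ?_ (norm_le_pi_norm (v - w) i)
  simp only [clamp, Pi.sub_apply, Real.norm_eq_abs]
  refine (abs_max_sub_max_le_max _ _ _ _).trans ?_
  rw [sub_self, abs_zero, max_eq_right (abs_nonneg _)]
  refine (abs_min_sub_min_le_max _ _ _ _).trans ?_
  rw [sub_self, abs_zero, max_eq_left (abs_nonneg _)]

theorem norm_clamp_le {R : ℝ} (hR : 0 ≤ R) (v : Fin n → ℝ) : ‖clamp R v‖ ≤ R := by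
  refine (pi_norm_le_iff_of_nonneg hR).2 fun i => abs_le.2 ⟨le_max_left _ _, ?_⟩
  exact max_le (by linarith) (min_le_right _ _)

theorem abs_clamp_apply_le {R : ℝ} (hR : 0 ≤ R) (v : Fin n → ℝ) (i : Fin n) :
    |clamp R v i| ≤ |v i| := by
  simp only [clamp]
  rcases le_total 0 (v i) with h | h
  · have h1 : 0 ≤ min (v i) R := le_min h hR
    rw [max_eq_right (by linarith), abs_of_nonneg h1, abs_of_nonneg h]
    exact min_le_left _ _
  · rw [min_eq_left (h.trans hR), abs_of_nonpos (max_le (by linarith) h), abs_of_nonpos h]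
    exact neg_le_neg (le_max_right _ _)

theorem clamp_eq_self {R : ℝ} {v : Fin n → ℝ} (h : ∀ i, |v i| ≤ R) : clamp R v = v := by
  ext i
  obtain ⟨h1, h2⟩ := abs_le.1 (h i)
  simp [clamp, h1, h2]

/-- Global existence. The Picard–Lindelöf theorem gives a solution of the truncated, hence bounded,
system `ẋ = A(t) (clamp R x)` on all of `[a, b]`. An energy estimate that does not depend on `R`
shows that for large `R` this solution is not affected by the truncation. -/
theorem exists_isSolution (hA : ContinuousOn A (Icc a b)) {t₀ : ℝ} (ht₀ : t₀ ∈ Icc a b)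
    (v : Fin n → ℝ) : ∃ x, x t₀ = v ∧ IsSolution A a b x := by
  obtain ⟨C', hC'⟩ := exists_bound_entries hA
  obtain ⟨C, hC0, hC⟩ : ∃ C, 0 ≤ C ∧ ∀ t ∈ Icc a b, ∀ i j, |A t i j| ≤ C :=
    ⟨|C'|, abs_nonneg _, fun t ht i j => (hC' t ht i j).trans (le_abs_self _)⟩
  set K : ℝ := 4 * C * n with hK
  have hK0 : 0 ≤ K := by positivity
  have hab : a ≤ b := ht₀.1.trans ht₀.2
  set R : ℝ := 1 + Real.exp (K * (b - a)) * ∑ i, v i ^ 2 with hR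
  have hR1 : 1 ≤ R := le_add_of_nonneg_right (by positivity)
  have hR0 : 0 ≤ R := zero_le_one.trans hR1
  have hba : 0 ≤ b - a := sub_nonneg.2 hab
  have hpl : IsPicardLindelof (fun t x => (A t).mulVec (clamp R x)) (⟨t₀, ht₀⟩ : Icc a b) v
      ⟨n * C * R * (b - a), by positivity⟩ 0 ⟨n * C * R, by positivity⟩ ⟨n * C, by positivity⟩ :=
    { lipschitzOnWith := fun t ht => LipschitzOnWith.of_dist_le_mul fun x _ y _ => by
        rw [dist_eq_norm, dist_eq_norm, ← Matrix.mulVec_sub]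
        exact (norm_mulVec_le hC0 (hC t ht) _).trans
          (mul_le_mul_of_nonneg_left (norm_clamp_sub_clamp_le R x y) (by positivity))
      continuousOn := fun x _ => by
        have : Continuous fun B : Matrix (Fin n) (Fin n) ℝ => B.mulVec (clamp R x) := by fun_prop
        exact this.comp_continuousOn hA
      norm_le := fun t ht x _ => (norm_mulVec_le hC0 (hC t ht) _).trans
        (mul_le_mul_of_nonneg_left (norm_clamp_le hR0 x) (by positivity))
      mul_max_le := by
        have : max (b - t₀) (t₀ - a) ≤ b - a :=
          max_le (by linarith [ht₀.1]) (by linarith [ht₀.2])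
        exact (mul_le_mul_of_nonneg_left this (by positivity : 0 ≤ n * C * R)).trans
          (sub_zero _).ge }
  obtain ⟨x, hx0, hx⟩ := hpl.exists_eq_forall_mem_Icc_hasDerivWithinAt₀
  have hx0 : x t₀ = v := hx0
  refine ⟨x, hx0, fun t ht => ?_⟩
  have hxc : ∀ i, ContinuousOn (fun τ => x τ i) (Icc a b) := fun i =>
    (continuous_apply i).comp_continuousOn fun τ hτ => (hx τ hτ).continuousWithinAt
  have hgc : ContinuousOn (fun τ => ∑ i, x τ i ^ 2) (Icc a b) :=
    continuousOn_finsetSum _ fun i _ => (hxc i).pow 2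
  have hgd : ∀ τ ∈ Ioo a b, HasDerivAt (fun τ => ∑ i, x τ i ^ 2)
      (∑ i, 2 * x τ i * ∑ j, A τ i j * clamp R (x τ) j) τ := fun τ hτ =>
    HasDerivAt.fun_sum fun i _ => by
      have := hasDerivAt_pi.1
        ((hx τ (Ioo_subset_Icc_self hτ)).hasDerivAt (Icc_mem_nhds hτ.1 hτ.2)) i
      simpa [Matrix.mulVec, dotProduct] using this.fun_pow 2
  have hgle : ∀ τ ∈ Ioo a b, |∑ i, 2 * x τ i * ∑ j, A τ i j * clamp R (x τ) j| ≤
      K * ∑ i, x τ i ^ 2 := fun τ hτ => by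
    calc |∑ i, 2 * x τ i * ∑ j, A τ i j * clamp R (x τ) j|
        = |∑ i, ∑ j, 2 * (x τ i * (A τ i j * clamp R (x τ) j))| := by
          simp only [Finset.mul_sum, mul_assoc]
      _ ≤ ∑ i, ∑ j, 2 * (C * (x τ i ^ 2 + x τ j ^ 2)) := by
          refine (Finset.abs_sum_le_sum_abs _ _).trans (Finset.sum_le_sum fun i _ => ?_)
          refine (Finset.abs_sum_le_sum_abs _ _).trans (Finset.sum_le_sum fun j _ => ?_)
          rw [abs_mul, abs_two, abs_mul, abs_mul, ← sq_abs (x τ i), ← sq_abs (x τ j)]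
          refine mul_le_mul_of_nonneg_left ?_ zero_le_two
          have h1 : |x τ i| * (|A τ i j| * |clamp R (x τ) j|) ≤ |x τ i| * (C * |x τ j|) := by
            exact mul_le_mul_of_nonneg_left (mul_le_mul (hC τ (Ioo_subset_Icc_self hτ) i j)
              (abs_clamp_apply_le hR0 _ _) (abs_nonneg _) hC0) (abs_nonneg _)
          refine h1.trans ?_
          have h2 : |x τ i| * |x τ j| ≤ |x τ i| ^ 2 + |x τ j| ^ 2 := by
            nlinarith [sq_nonneg (|x τ i| - |x τ j|), sq_nonneg (|x τ i|), sq_nonneg (|x τ j|)]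
          calc |x τ i| * (C * |x τ j|) = C * (|x τ i| * |x τ j|) := by ring
            _ ≤ _ := mul_le_mul_of_nonneg_left h2 hC0
      _ = K * ∑ i, x τ i ^ 2 := by
          simp only [mul_add, Finset.sum_add_distrib, Finset.sum_const, ← Finset.mul_sum,
            Finset.card_univ, nsmul_eq_mul, Fintype.card_fin, hK]
          ring
  have hg : ∑ i, x t i ^ 2 ≤ Real.exp (K * (b - a)) * ∑ i, v i ^ 2 := by
    rw [← hx0]
    have hexp : ∀ c : ℝ, c ≤ b - a → Real.exp (K * c) * ∑ i, x t₀ i ^ 2 ≤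
        Real.exp (K * (b - a)) * ∑ i, x t₀ i ^ 2 := fun c hc => by gcongr
    rcases le_total t₀ t with h | h
    · have hsub : Ioo t₀ t ⊆ Ioo a b := Ioo_subset_Ioo ht₀.1 ht.2
      exact (le_mul_exp_of_deriv_le h (hgc.mono (Icc_subset_Icc ht₀.1 ht.2))
        (fun τ hτ => hgd τ (hsub hτ))
        (fun τ hτ => (abs_le.1 (hgle τ (hsub hτ))).2)).trans
        (hexp _ (by linarith [ht₀.1, ht.2]))
    · have hsub : Ioo t t₀ ⊆ Ioo a b := Ioo_subset_Ioo ht.1 ht₀.2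
      exact (le_exp_mul_of_neg_le_deriv h (hgc.mono (Icc_subset_Icc ht.1 ht₀.2))
        (fun τ hτ => hgd τ (hsub hτ))
        (fun τ hτ => (abs_le.1 (hgle τ (hsub hτ))).1)).trans
        (hexp _ (by linarith [ht₀.2, ht.1]))
  have hxR : ∀ i, |x t i| ≤ R := fun i => by
    refine abs_le_of_sq_le_sq ?_ hR0
    have h1 : x t i ^ 2 ≤ ∑ i, x t i ^ 2 :=
      Finset.single_le_sum (f := fun i => x t i ^ 2) (fun _ _ => sq_nonneg _) (Finset.mem_univ i)
    have h2 : x t i ^ 2 ≤ R := by linarith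
    nlinarith
  have := hx t ht
  simp only [clamp_eq_self hxR] at this
  exact this

theorem IsSolution.hasDerivAt {x : ℝ → Fin n → ℝ} (hx : IsSolution A a b x) {t : ℝ}
    (ht : t ∈ Ioo a b) (i : Fin n) : HasDerivAt (fun τ => x τ i) (∑ j, A t i j * x t j) t :=
  hasDerivAt_pi.1 ((hx t (Ioo_subset_Icc_self ht)).hasDerivAt (Icc_mem_nhds ht.1 ht.2)) i

theorem IsSolution.continuousOn {x : ℝ → Fin n → ℝ} (hx : IsSolution A a b x) :
    ContinuousOn x (Icc a b) := fun t ht => (hx t ht).continuousWithinAt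

/-- Forward uniqueness. -/
theorem IsSolution.eq_of_eq {x y : ℝ → Fin n → ℝ} (hA : ContinuousOn A (Icc a b))
    (hx : IsSolution A a b x) (hy : IsSolution A a b y) {s t : ℝ} (hs : a ≤ s) (hst : s ≤ t)
    (ht : t ≤ b) (h : x s = y s) : x t = y t := by
  obtain ⟨C, hC⟩ := exists_bound_entries hA
  have hsub : Ioo s t ⊆ Ioo a b := Ioo_subset_Ioo hs ht
  have key := eq_zero_of_block_triangular (w := fun τ i => x τ i - y τ i) (M := A) (C := C)
    (S := Set.univ) hst
    (fun i => ((continuous_apply i).comp_continuousOn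
      (hx.continuousOn.mono (Icc_subset_Icc hs ht))).sub ((continuous_apply i).comp_continuousOn
      (hy.continuousOn.mono (Icc_subset_Icc hs ht))))
    (fun τ hτ i => by
      have := (hx.hasDerivAt (hsub hτ) i).fun_sub (hy.hasDerivAt (hsub hτ) i)
      simpa only [mul_sub, Finset.sum_sub_distrib] using this)
    (fun τ hτ => hC τ (Ioo_subset_Icc_self (hsub hτ)))
    (by simp) (by simp [h])
  exact funext fun i => sub_eq_zero.1 (key i trivial)

variable {k : ℕ}

/-- `X` solves the matrix equation `Ẋ = A(t) X` on `[a, b]`. -/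
def IsMatrixSolution (A : ℝ → Matrix (Fin n) (Fin n) ℝ) (a b : ℝ)
    (X : ℝ → Matrix (Fin n) (Fin k) ℝ) : Prop :=
  ∀ j, IsSolution A a b fun t i => X t i j

theorem exists_isMatrixSolution (hA : ContinuousOn A (Icc a b)) {t₀ : ℝ} (ht₀ : t₀ ∈ Icc a b)
    (U : Matrix (Fin n) (Fin k) ℝ) : ∃ X, X t₀ = U ∧ IsMatrixSolution A a b X := by
  have h : ∀ j, ∃ x, x t₀ = (fun i => U i j) ∧ IsSolution A a b x := fun j =>
    exists_isSolution hA ht₀ _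
  choose x hx0 hx using h
  exact ⟨fun t => Matrix.of fun i j => x j t i,
    Matrix.ext fun i j => congrFun (hx0 j) i, fun j => hx j⟩

theorem IsMatrixSolution.mulVec {X : ℝ → Matrix (Fin n) (Fin k) ℝ}
    (hX : IsMatrixSolution A a b X) (d : Fin k → ℝ) :
    IsSolution A a b fun t => (X t).mulVec d := by
  intro t ht
  have h := HasDerivWithinAt.fun_sum (u := Finset.univ) fun j (_ : j ∈ Finset.univ) =>
    (hX j t ht).const_smul (d j)
  have h1 : ∀ τ, (X τ).mulVec d = ∑ j, d j • fun i => X τ i j := fun τ => by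
    ext i
    simp [Matrix.mulVec, dotProduct, mul_comm]
  have h2 : (A t).mulVec ((X t).mulVec d) = ∑ j, d j • (A t).mulVec fun i => X t i j := by
    rw [h1, Matrix.mulVec_sum]
    simp only [Matrix.mulVec_smul]
  rw [h2, funext h1]
  exact h

theorem IsMatrixSolution.continuousOn_minors {X : ℝ → Matrix (Fin n) (Fin k) ℝ}
    (hX : IsMatrixSolution A a b X) (α : Fin k ↪o Fin n) :
    ContinuousOn (fun t => minors (X t) α) (Icc a b) := by
  have h : ∀ i j, ContinuousOn (fun t => X t i j) (Icc a b) := fun i j =>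
    (continuous_apply i).comp_continuousOn (hX j).continuousOn
  have h1 : ContinuousOn (fun t => (X t).submatrix α id) (Icc a b) :=
    continuousOn_pi.2 fun i => continuousOn_pi.2 fun j => h _ _
  exact (Continuous.matrix_det continuous_id).comp_continuousOn h1

theorem IsMatrixSolution.hasDerivAt_minors {X : ℝ → Matrix (Fin n) (Fin k) ℝ}
    (hX : IsMatrixSolution A a b X) {t : ℝ} (ht : t ∈ Ioo a b) (α : Fin k ↪o Fin n) :
    HasDerivAt (fun s => minors (X s) α) (∑ β, addCompound k (A t) α β * minors (X t) β) t :=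
  KPositive.hasDerivAt_minors (fun i j => (hX j).hasDerivAt ht i) α

theorem exists_bound_addCompound (k : ℕ) (hA : ContinuousOn A (Icc a b)) :
    ∃ C, ∀ t ∈ Icc a b, ∀ α β, |addCompound k (A t) α β| ≤ C :=
  exists_bound_of_continuousOn fun α β => continuousOn_addCompound hA α β

end

/-! ### Matrices with nonnegative or positive maximal minors and sign variations -/

section
variable {n k : ℕ}

/-- If all maximal minors of `X` are positive, every nonzero vector in its column space has at most
`k` weak sign variations. -/
theorem mulVec_mem_PPlus {X : Matrix (Fin n) (Fin (k + 1)) ℝ} (hX : ∀ α, 0 < minors X α)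
    {d : Fin (k + 1) → ℝ} (hd : d ≠ 0) : X.mulVec d ∈ PPlus n (k + 1) := by
  refine mem_PPlus_iff.2 ?_
  rintro ⟨δ, σ, hσ, h⟩
  set y := X.mulVec d with hy
  -- The matrix `[y | X]`, restricted to the rows `δ`, is singular; expanding its determinant along
  -- the first column gives a vanishing sum of terms of the same sign.
  let N : Matrix (Fin (k + 2)) (Fin (k + 2)) ℝ :=
    Matrix.of fun p => Fin.cons (y (δ p)) fun c => X (δ p) c
  have hN : N.det = 0 := by
    refine Matrix.exists_mulVec_eq_zero_iff.1 ⟨Fin.cons 1 (-d), fun h0 => ?_, ?_⟩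
    · simpa using congrFun h0 0
    · ext p
      simp [N, Matrix.mulVec, dotProduct, Fin.sum_univ_succ, hy]
  rw [Matrix.det_succ_column_zero] at hN
  have hsub : ∀ p : Fin (k + 2), (N.submatrix p.succAbove Fin.succ).det =
      minors X (p.succAboveOrderEmb.trans δ) := fun p => by
    refine congrArg Matrix.det (Matrix.ext fun i j => ?_)
    simp [N]
  have hN' : ∑ p : Fin (k + 2), σ * (-1) ^ (p : ℕ) * y (δ p) *
      minors X (p.succAboveOrderEmb.trans δ) = 0 := by
    calc _ = σ * ∑ p : Fin (k + 2), (-1) ^ (p : ℕ) * N p 0 *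
          (N.submatrix p.succAbove Fin.succ).det := by
          rw [Finset.mul_sum]
          refine Finset.sum_congr rfl fun p _ => ?_
          rw [hsub]
          simp [N, mul_assoc]
      _ = 0 := by rw [hN, mul_zero]
  have hzero : ∀ p, y (δ p) = 0 := fun p => by
    have := (Finset.sum_eq_zero_iff_of_nonneg fun p _ => mul_nonneg (h p) (hX _).le).1 hN' p
      (Finset.mem_univ p)
    have h1 : σ * (-1) ^ (p : ℕ) ≠ 0 := mul_ne_zero hσ (pow_ne_zero _ (by norm_num))
    simpa [h1, (hX _).ne'] using this
  refine (hX ((0 : Fin (k + 2)).succAboveOrderEmb.trans δ)).ne' ?_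
  exact Matrix.exists_mulVec_eq_zero_iff.1 ⟨d, hd, funext fun r => hzero _⟩

/-- A vector with at most `k` sign variations is a combination of the columns of an `n × (k + 1)`
matrix with nonnegative maximal minors, not all zero: the columns are supported on the blocks of
`exists_blocks`. -/
theorem exists_matrix_of_mem_PMinus (hkn : k + 1 ≤ n) {x : Fin n → ℝ}
    (hx : x ∈ PMinus n (k + 1)) : ∃ (U : Matrix (Fin n) (Fin (k + 1)) ℝ) (d : Fin (k + 1) → ℝ),
      U.mulVec d = x ∧ (∀ α, 0 ≤ minors U α) ∧ ∃ β, 0 < minors U β := by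
  classical
  obtain ⟨b, hmono, hsurj, hb⟩ := exists_blocks hkn hx
  -- `j c` is an index in the block `c`, with `x (j c) ≠ 0` unless `x` vanishes on the block.
  have hex : ∀ c, ∃ j, b j = c ∧ (x j = 0 → ∀ i, b i = c → x i = 0) := fun c => by
    by_cases h : ∃ j, b j = c ∧ x j ≠ 0
    · obtain ⟨j, hj, hxj⟩ := h
      exact ⟨j, hj, fun h0 => absurd h0 hxj⟩
    · obtain ⟨j, hj⟩ := hsurj c
      refine ⟨j, hj, fun _ i hi => ?_⟩
      by_contra hne
      exact h ⟨i, hi, hne⟩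
  choose j hbj hj using hex
  let U : Matrix (Fin n) (Fin (k + 1)) ℝ :=
    Matrix.of fun i c => if b i = c then (if x (j c) = 0 then 1 else x i / x (j c)) else 0
  have hU0 : ∀ i c, b i ≠ c → U i c = 0 := fun i c h => by simp [U, h]
  have hUnn : ∀ i, 0 ≤ U i (b i) := fun i => by
    by_cases h : x (j (b i)) = 0
    · simp [U, h]
    · have := hb i (j (b i)) (hbj _).symm
      simp only [U, Matrix.of_apply, if_true, h, if_false]
      rw [div_eq_mul_inv]
      have h1 : x i * (x (j (b i)))⁻¹ =
          x i * x (j (b i)) * ((x (j (b i)))⁻¹ * (x (j (b i)))⁻¹) := by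
        field_simp
      rw [h1]
      exact mul_nonneg this (mul_self_nonneg _)
  have hdiag : ∀ α : Fin (k + 1) ↪o Fin n, (∀ r, b (α r) = r) →
      minors U α = ∏ r, U (α r) r := fun α hα => by
    have : U.submatrix α id = Matrix.diagonal fun r => U (α r) r := by
      ext r c
      by_cases h : r = c
      · subst h; simp
      · rw [Matrix.diagonal_apply_ne _ h]
        exact hU0 _ _ (by rw [hα]; exact h)
    rw [minors, this, Matrix.det_diagonal]
  refine ⟨U, fun c => x (j c), ?_, fun α => ?_, ?_⟩
  · ext i
    simp only [Matrix.mulVec, dotProduct]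
    rw [Finset.sum_eq_single (b i) (fun c _ hc => by rw [hU0 i c hc.symm, zero_mul]) (by simp)]
    by_cases h : x (j (b i)) = 0
    · rw [h, mul_zero, hj _ h i rfl]
    · simp [U, h]
  · by_cases hs : Function.Surjective fun r => b (α r)
    · have hinj : Function.Injective fun r => b (α r) := Finite.injective_iff_surjective.2 hs
      have hsm : StrictMono fun r => b (α r) :=
        (hmono.comp α.monotone).strictMono_of_injective hinj
      have hid : OrderEmbedding.ofStrictMono _ hsm = RelEmbedding.refl _ :=
        orderEmb_eq_of_range_eq (by
          rw [OrderEmbedding.coe_ofStrictMono, hs.range_eq]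
          exact Set.range_id.symm)
      have hid' : ∀ r, b (α r) = r := fun r => DFunLike.congr_fun hid r
      rw [hdiag α hid']
      refine Finset.prod_nonneg fun r _ => ?_
      have := hUnn (α r)
      rwa [hid'] at this
    · obtain ⟨c, hc⟩ := not_forall.1 hs
      refine (Matrix.det_eq_zero_of_column_eq_zero c fun r => ?_).ge
      exact hU0 _ _ fun h => hc ⟨r, h⟩
  · have hjm : StrictMono j := fun c c' hcc => by
      by_contra hcon
      have := hmono (not_lt.1 hcon)
      rw [hbj, hbj] at this
      exact absurd hcc (not_lt.2 this)
    refine ⟨OrderEmbedding.ofStrictMono j hjm, ?_⟩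
    rw [hdiag _ hbj]
    refine Finset.prod_pos fun r _ => ?_
    by_cases h : x (j r) = 0 <;> simp [U, hbj, h]

/-! ### Propagation of positive minors along a flow -/

variable {A : ℝ → Matrix (Fin n) (Fin n) ℝ} {a b : ℝ} {X : ℝ → Matrix (Fin n) (Fin k) ℝ}

theorem minors_nonneg_of_isMetzler (hA : ContinuousOn A (Icc a b))
    (hM : ∀ t ∈ Ioo a b, IsMetzler (addCompound k (A t))) (hX : IsMatrixSolution A a b X)
    {s t : ℝ} (hs : a ≤ s) (hst : s ≤ t) (ht : t ≤ b) (h0 : ∀ α, 0 ≤ minors (X s) α)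
    (α : Fin k ↪o Fin n) : 0 ≤ minors (X t) α := by
  obtain ⟨C, hC⟩ := exists_bound_addCompound k hA
  have hsub : Ioo s t ⊆ Ioo a b := Ioo_subset_Ioo hs ht
  exact nonneg_of_isMetzler (w := fun τ α => minors (X τ) α) hst
    (fun α => (hX.continuousOn_minors α).mono (Icc_subset_Icc hs ht))
    (fun τ hτ α => hX.hasDerivAt_minors (hsub hτ) α)
    (fun τ hτ => hC τ (Ioo_subset_Icc_self (hsub hτ))) (fun τ hτ => hM τ (hsub hτ)) h0 α

theorem minors_pos_of_isMetzler (hA : ContinuousOn A (Icc a b))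
    (hM : ∀ t ∈ Ioo a b, IsMetzler (addCompound k (A t))) (hX : IsMatrixSolution A a b X)
    {s t : ℝ} (hs : a ≤ s) (hst : s ≤ t) (ht : t ≤ b) (h0 : ∀ α, 0 ≤ minors (X s) α)
    {α : Fin k ↪o Fin n} (hα : 0 < minors (X s) α) : 0 < minors (X t) α := by
  obtain ⟨C, hC⟩ := exists_bound_addCompound k hA
  have hsub : Ioo s t ⊆ Ioo a b := Ioo_subset_Ioo hs ht
  exact pos_of_isMetzler (w := fun τ α => minors (X τ) α) hst
    (fun α => (hX.continuousOn_minors α).mono (Icc_subset_Icc hs ht))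
    (fun τ hτ α => hX.hasDerivAt_minors (hsub hτ) α)
    (fun τ hτ => hC τ (Ioo_subset_Icc_self (hsub hτ))) (fun τ hτ => hM τ (hsub hτ))
    (fun τ hτ => minors_nonneg_of_isMetzler hA hM hX hs hτ.1.le (hτ.2.le.trans ht) h0) hα

theorem minors_pos_of_interior_reducibleTimes_eq_empty (hA : ContinuousOn A (Icc a b))
    (hM : ∀ t ∈ Ioo a b, IsMetzler (addCompound k (A t)))
    (hE : interior (reducibleTimes k A a b) = ∅) (hX : IsMatrixSolution A a b X)
    {s t : ℝ} (hs : a ≤ s) (hst : s < t) (ht : t ≤ b) (h0 : ∀ α, 0 ≤ minors (X s) α)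
    {β : Fin k ↪o Fin n} (hβ : 0 < minors (X s) β) (α : Fin k ↪o Fin n) :
    0 < minors (X t) α := by
  obtain ⟨C, hC⟩ := exists_bound_addCompound k hA
  have hsub : Ioo s t ⊆ Ioo a b := Ioo_subset_Ioo hs ht
  refine pos_of_isIrreducibleMatrix (w := fun τ α => minors (X τ) α) hst
    (fun α => (hX.continuousOn_minors α).mono (Icc_subset_Icc hs ht))
    (fun τ hτ α => hX.hasDerivAt_minors (hsub hτ) α)
    (fun τ hτ => hC τ (Ioo_subset_Icc_self (hsub hτ))) (fun τ hτ => hM τ (hsub hτ))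
    (fun r hr => ?_) h0 hβ α
  by_contra hcon
  push Not at hcon
  have h1 : Ioo s r ⊆ interior (reducibleTimes k A a b) :=
    interior_maximal (fun τ hτ => ⟨hsub ⟨hτ.1, hτ.2.trans hr.2⟩, hcon τ hτ⟩) isOpen_Ioo
  rw [hE, Set.subset_empty_iff, Ioo_eq_empty_iff] at h1
  exact h1 hr.1

/-! ### The path matrix, whose compounds are Metzler and irreducible -/

/-- The adjacency matrix of the path with vertices `0, 1, …, n - 1`. -/
def pathMatrix (n : ℕ) : Matrix (Fin n) (Fin n) ℝ :=
  Matrix.of fun i j => if (i : ℕ) + 1 = j ∨ (j : ℕ) + 1 = i then 1 else 0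

theorem exists_lt_succAbove {r c : Fin (k + 1)} (h : r < c) :
    ∃ s : Fin k, r < r.succAbove s ∧ c.succAbove s < c := by
  have hr : (r : ℕ) < k := by omega
  have hcast : Fin.castSucc (⟨r, hr⟩ : Fin k) = r := Fin.ext rfl
  refine ⟨⟨r, hr⟩, ?_, ?_⟩
  · rw [Fin.succAbove_of_le_castSucc r ⟨r, hr⟩ hcast.ge, Fin.lt_def]
    exact Nat.lt_succ_self _
  · rw [Fin.succAbove_of_castSucc_lt c ⟨r, hr⟩ h]
    exact h

/-- Two sequences that agree after removal of adjacent integers `α r`, `β c` have these at the same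
position: a term of the common subsequence would otherwise lie strictly between the two. -/
theorem not_lt_of_succAbove_trans_eq {α β : Fin (k + 1) ↪o Fin n} {r c : Fin (k + 1)}
    (hadj : (α r : ℕ) + 1 = β c ∨ (β c : ℕ) + 1 = α r)
    (h : r.succAboveOrderEmb.trans α = c.succAboveOrderEmb.trans β) : ¬ r < c := by
  intro hlt
  obtain ⟨s, h1, h2⟩ := exists_lt_succAbove hlt
  have h3 : α (r.succAbove s) = β (c.succAbove s) := DFunLike.congr_fun h s
  have h4 := α.strictMono h1
  have h5 := β.strictMono h2
  rw [h3, Fin.lt_def] at h4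
  rw [Fin.lt_def] at h5
  omega

theorem eq_of_succAbove_trans_eq {α β : Fin (k + 1) ↪o Fin n} {r c : Fin (k + 1)}
    (hadj : (α r : ℕ) + 1 = β c ∨ (β c : ℕ) + 1 = α r)
    (h : r.succAboveOrderEmb.trans α = c.succAboveOrderEmb.trans β) : r = c :=
  le_antisymm (not_lt.1 (not_lt_of_succAbove_trans_eq hadj.symm h.symm))
    (not_lt.1 (not_lt_of_succAbove_trans_eq hadj h))

theorem addCompound_pathMatrix_term_nonneg (α β : Fin (k + 1) ↪o Fin n) (r c : Fin (k + 1)) :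
    0 ≤ (-1) ^ (r + c : ℕ) * pathMatrix n (α r) (β c) *
        if r.succAboveOrderEmb.trans α = c.succAboveOrderEmb.trans β then (1 : ℝ) else 0 := by
  by_cases h : r.succAboveOrderEmb.trans α = c.succAboveOrderEmb.trans β
  · by_cases hadj : (α r : ℕ) + 1 = β c ∨ (β c : ℕ) + 1 = α r
    · rw [eq_of_succAbove_trans_eq hadj h, ← two_mul, pow_mul]
      simp only [pathMatrix, Matrix.of_apply]
      split_ifs <;> simp
    · simp [pathMatrix, hadj]
  · simp [h]

theorem isMetzler_addCompound_pathMatrix :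
    IsMetzler (addCompound (k + 1) (pathMatrix n)) := fun α β _ => by
  rw [addCompound_apply]
  exact Finset.sum_nonneg fun c _ => Finset.sum_nonneg fun r _ =>
    addCompound_pathMatrix_term_nonneg α β r c

theorem addCompound_pathMatrix_ne_zero {α β : Fin (k + 1) ↪o Fin n} {r : Fin (k + 1)}
    (hadj : (α r : ℕ) + 1 = β r ∨ (β r : ℕ) + 1 = α r)
    (h : r.succAboveOrderEmb.trans α = r.succAboveOrderEmb.trans β) :
    addCompound (k + 1) (pathMatrix n) α β ≠ 0 := by
  have hnn := addCompound_pathMatrix_term_nonneg α β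
  rw [addCompound_apply]
  have h1 : ∀ c ∈ (Finset.univ : Finset (Fin (k + 1))), 0 ≤ ∑ r' : Fin (k + 1),
      (-1) ^ (r' + c : ℕ) * pathMatrix n (α r') (β c) *
        if r'.succAboveOrderEmb.trans α = c.succAboveOrderEmb.trans β then (1 : ℝ) else 0 :=
    fun c _ => Finset.sum_nonneg fun r' _ => hnn r' c
  intro h0
  have h2 := (Finset.sum_eq_zero_iff_of_nonneg h1).1 h0 r (Finset.mem_univ r)
  have h3 := (Finset.sum_eq_zero_iff_of_nonneg fun r' _ => hnn r' r).1 h2 r (Finset.mem_univ r)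
  rw [if_pos h] at h3
  simp [pathMatrix, hadj] at h3

/-- Every increasing sequence other than `0, 1, …, k` can be lowered by one at a single place: the
first at which it differs from `0, 1, …, k`. -/
theorem exists_lowered (α : Fin (k + 1) ↪o Fin n) (h : ∃ r, (α r : ℕ) ≠ r) :
    ∃ (β : Fin (k + 1) ↪o Fin n) (r : Fin (k + 1)), (β r : ℕ) + 1 = α r ∧
      r.succAboveOrderEmb.trans α = r.succAboveOrderEmb.trans β := by
  classical
  obtain ⟨r, hr, hmin⟩ : ∃ r, (α r : ℕ) ≠ r ∧ ∀ s < r, (α s : ℕ) = s := by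
    let s := Finset.univ.filter fun r => (α r : ℕ) ≠ r
    have hs : s.Nonempty := h.imp fun r hr => by simpa [s] using hr
    refine ⟨s.min' hs, by simpa [s] using s.min'_mem hs, fun r hr => ?_⟩
    by_contra hne
    exact absurd hr (not_lt.2 (s.min'_le r (by simpa [s] using hne)))
  have hge : ∀ m : ℕ, ∀ hm : m < k + 1, m ≤ α ⟨m, hm⟩ := by
    intro m
    induction m with
    | zero => exact fun _ => Nat.zero_le _
    | succ m ih =>
      intro hm
      have h1 := ih (by omega)
      have h2 : α ⟨m, by omega⟩ < α ⟨m + 1, hm⟩ := α.strictMono (by simp [Fin.lt_def])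
      rw [Fin.lt_def] at h2
      omega
  have hgt : (r : ℕ) < α r := lt_of_le_of_ne (hge r r.2) (Ne.symm hr)
  let f : Fin (k + 1) → Fin n := Function.update α r ⟨α r - 1, by omega⟩
  have hfr : (f r : ℕ) = α r - 1 := by simp [f]
  have hfs : ∀ s, s ≠ r → f s = α s := fun s hs => by simp [f, hs]
  have hf : StrictMono f := by
    intro s s' hss
    rw [Fin.lt_def]
    by_cases h1 : s = r
    · subst h1
      have h2 := α.strictMono hss
      rw [hfr, hfs s' hss.ne']
      rw [Fin.lt_def] at h2
      omega
    · by_cases h2 : s' = r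
      · subst h2
        rw [hfr, hfs s h1, hmin s hss]
        rw [Fin.lt_def] at hss
        omega
      · rw [hfs s h1, hfs s' h2]
        exact α.strictMono hss
  refine ⟨OrderEmbedding.ofStrictMono f hf, r, ?_, ?_⟩
  · rw [OrderEmbedding.coe_ofStrictMono, hfr]
    omega
  · ext s
    change (α (r.succAbove s) : ℕ) = f (r.succAbove s)
    rw [hfs _ (Fin.succAbove_ne r s)]

theorem isIrreducibleMatrix_addCompound_pathMatrix :
    IsIrreducibleMatrix (addCompound (k + 1) (pathMatrix n)) := by
  intro S hS hSc
  by_contra hcon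
  push Not at hcon
  -- Lowering a sequence does not leave `S` or its complement, so that all sequences are on the same
  -- side as `0, 1, …, k`.
  have key : ∀ N : ℕ, ∀ α β : Fin (k + 1) ↪o Fin n,
      ∑ r, (α r : ℕ) + ∑ r, (β r : ℕ) = N → α ∈ S → β ∈ Sᶜ → False := by
    intro N
    induction N using Nat.strong_induction_on with
    | _ N ih =>
      have hlow : ∀ α γ : Fin (k + 1) ↪o Fin n, ∀ r : Fin (k + 1), (γ r : ℕ) + 1 = α r →
          r.succAboveOrderEmb.trans α = r.succAboveOrderEmb.trans γ →
          ∑ s, (γ s : ℕ) < ∑ s, (α s : ℕ) := fun α γ r hr h => by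
        refine Finset.sum_lt_sum (fun s _ => ?_) ⟨r, Finset.mem_univ r, by omega⟩
        by_cases hs : s = r
        · subst hs; omega
        · obtain ⟨z, rfl⟩ := Fin.exists_succAbove_eq hs
          have : α (r.succAbove z) = γ (r.succAbove z) := DFunLike.congr_fun h z
          rw [this]
      intro α β hN hα hβ
      by_cases h1 : ∃ r, (α r : ℕ) ≠ r
      · obtain ⟨γ, r, hr, h⟩ := exists_lowered α h1
        have hlt := hlow α γ r hr h
        by_cases hγ : γ ∈ S
        · exact ih _ (by omega) γ β rfl hγ hβ
        · exact addCompound_pathMatrix_ne_zero (Or.inr hr) h (hcon α hα γ hγ)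
      · by_cases h2 : ∃ r, (β r : ℕ) ≠ r
        · obtain ⟨γ, r, hr, h⟩ := exists_lowered β h2
          have hlt := hlow β γ r hr h
          by_cases hγ : γ ∈ S
          · exact addCompound_pathMatrix_ne_zero (Or.inl hr) h.symm (hcon γ hγ β hβ)
          · exact ih _ (by omega) α γ rfl hα hγ
        · push Not at h1 h2
          have : α = β := by
            ext r
            rw [h1, h2]
          exact hβ (this ▸ hα)
  obtain ⟨α, hα⟩ := hS
  obtain ⟨β, hβ⟩ := hSc
  exact key _ α β rfl hα hβ

/-- If the maximal minors of `X` are nonnegative and not all zero, the vectors in its column space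
have at most `k` sign variations. Following the flow of the path matrix for a short time makes all
the minors positive, and `PMinus` is closed. -/
theorem mulVec_mem_PMinus {X : Matrix (Fin n) (Fin (k + 1)) ℝ} (hX : ∀ α, 0 ≤ minors X α)
    {β : Fin (k + 1) ↪o Fin n} (hβ : 0 < minors X β) (d : Fin (k + 1) → ℝ) :
    X.mulVec d ∈ PMinus n (k + 1) := by
  by_cases hd : d = 0
  · rw [hd, Matrix.mulVec_zero]
    exact mem_PMinus_of_support β fun _ _ => rfl
  have hcont : ContinuousOn (fun _ : ℝ => pathMatrix n) (Icc (-1) 1) := continuousOn_const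
  obtain ⟨Z, hZ0, hZ⟩ := exists_isMatrixSolution hcont (t₀ := 0) (by simp) X
  have hE : interior (reducibleTimes (k + 1) (fun _ : ℝ => pathMatrix n) (-1) 1) = ∅ := by
    have : reducibleTimes (k + 1) (fun _ : ℝ => pathMatrix n) (-1) 1 = ∅ :=
      Set.eq_empty_of_forall_notMem fun t ht => ht.2 isIrreducibleMatrix_addCompound_pathMatrix
    rw [this, interior_empty]
  have hmem : ∀ t ∈ Ioo (0 : ℝ) 1, (Z t).mulVec d ∈ PMinus n (k + 1) := fun t ht =>
    PPlus_subset_PMinus k <| mulVec_mem_PPlus (fun α =>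
      minors_pos_of_interior_reducibleTimes_eq_empty hcont
        (fun _ _ => isMetzler_addCompound_pathMatrix) hE hZ (by norm_num) ht.1 ht.2.le
        (fun α => by rw [hZ0]; exact hX α) (by rw [hZ0]; exact hβ) α) hd
  have htend : Tendsto (fun t => (Z t).mulVec d) (𝓝[>] 0) (𝓝 ((Z 0).mulVec d)) :=
    (((hZ.mulVec d).continuousOn.continuousAt
      (Icc_mem_nhds (by norm_num) (by norm_num))).tendsto).mono_left nhdsWithin_le_nhds
  rw [← hZ0]
  exact (isClosed_PMinus k).mem_of_tendsto htend
    (by filter_upwards [Ioo_mem_nhdsGT (zero_lt_one' ℝ)] with t ht using hmem t ht)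

end

/-! ### Sufficiency -/

section
variable {n k : ℕ} {A : ℝ → Matrix (Fin n) (Fin n) ℝ} {a b : ℝ}

/-- The common part of both sufficiency proofs: from time `t₀` on, a solution starting in `PMinus`
is a fixed combination of the columns of a matrix solution with nonnegative minors. -/
theorem exists_isMatrixSolution_of_mem_PMinus (hkn : k + 1 ≤ n) (hA : ContinuousOn A (Icc a b))
    {x : ℝ → Fin n → ℝ} (hx : IsSolution A a b x) {t₀ : ℝ} (ht₀ : t₀ ∈ Icc a b)
    (h : x t₀ ∈ PMinus n (k + 1)) :
    ∃ (X : ℝ → Matrix (Fin n) (Fin (k + 1)) ℝ) (d : Fin (k + 1) → ℝ), IsMatrixSolution A a b X ∧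
      (∀ t, t₀ ≤ t → t ≤ b → x t = (X t).mulVec d) ∧
      (∀ α, 0 ≤ minors (X t₀) α) ∧ ∃ β, 0 < minors (X t₀) β := by
  obtain ⟨U, d, hUd, hU, hβ⟩ := exists_matrix_of_mem_PMinus hkn h
  obtain ⟨X, rfl, hX⟩ := exists_isMatrixSolution hA ht₀ U
  exact ⟨X, d, hX, fun t h1 h2 => hx.eq_of_eq hA (hX.mulVec d) ht₀.1 h1 h2 hUd.symm, hU, hβ⟩

theorem isKPositive_of_isMetzler (hkn : k + 1 ≤ n) (hA : ContinuousOn A (Icc a b))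
    (hM : ∀ t ∈ Ioo a b, IsMetzler (addCompound (k + 1) (A t))) :
    IsKPositive (k + 1) A a b := by
  intro x hx t₀ h1 h2 h t htt htb
  obtain ⟨X, d, hX, hxX, hnn, β, hβ⟩ :=
    exists_isMatrixSolution_of_mem_PMinus hkn hA hx ⟨h1.le, h2.le⟩ h
  rw [hxX t htt htb.le]
  exact mulVec_mem_PMinus (minors_nonneg_of_isMetzler hA hM hX h1.le htt htb.le hnn)
    (minors_pos_of_isMetzler hA hM hX h1.le htt htb.le hnn hβ) d

theorem isStronglyKPositive_of_isMetzler (hkn : k + 1 ≤ n) (hA : ContinuousOn A (Icc a b))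
    (hM : ∀ t ∈ Ioo a b, IsMetzler (addCompound (k + 1) (A t)))
    (hE : interior (reducibleTimes (k + 1) A a b) = ∅) :
    IsStronglyKPositive (k + 1) A a b := by
  intro x hx t₀ h1 h2 h0 h t htt htb
  obtain ⟨X, d, hX, hxX, hnn, β, hβ⟩ :=
    exists_isMatrixSolution_of_mem_PMinus hkn hA hx ⟨h1.le, h2.le⟩ h
  rw [hxX t htt.le htb.le]
  refine mulVec_mem_PPlus (minors_pos_of_interior_reducibleTimes_eq_empty hA hM hE hX h1.le htt
    htb.le hnn hβ) fun hd => h0 ?_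
  rw [hxX t₀ le_rfl h2.le, hd, Matrix.mulVec_zero]

theorem IsStronglyKPositive.isKPositive (hkn : k + 1 ≤ n) (hA : ContinuousOn A (Icc a b))
    (h : IsStronglyKPositive (k + 1) A a b) : IsKPositive (k + 1) A a b := by
  intro x hx t₀ h1 h2 hmem t htt htb
  rcases htt.eq_or_lt with rfl | hlt
  · exact hmem
  by_cases h0 : x t₀ = 0
  · have hzero : IsSolution A a b fun _ => 0 := fun t _ => by
      rw [Matrix.mulVec_zero]
      exact hasDerivWithinAt_const _ _ _
    rw [hx.eq_of_eq hA hzero h1.le htt htb.le h0, ← h0]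
    exact h0 ▸ mem_PMinus_of_support (Fin.castLEOrderEmb hkn) fun _ _ => rfl
  · exact PPlus_subset_PMinus k (h x hx t₀ h1 h2 h0 hmem t hlt htb)

/-! ### Necessity of the Metzler property -/

theorem range_succAboveOrderEmb_trans {m : ℕ} (δ : Fin (m + 1) ↪o Fin n) (p : Fin (m + 1)) :
    Set.range (p.succAboveOrderEmb.trans δ) = Set.range δ \ {δ p} := by
  have : ⇑(p.succAboveOrderEmb.trans δ) = δ ∘ p.succAbove := rfl
  rw [this, Set.range_comp, Fin.range_succAbove, Set.compl_eq_univ_sdiff,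
    Set.image_sdiff δ.injective, Set.image_univ, Set.image_singleton]

theorem exists_insert {m : ℕ} (β : Fin m ↪o Fin n) {i : Fin n} (hi : i ∉ Set.range β) :
    ∃ (δ : Fin (m + 1) ↪o Fin n) (p : Fin (m + 1)), δ p = i ∧
      p.succAboveOrderEmb.trans δ = β := by
  classical
  let s : Finset (Fin n) := insert i (Finset.univ.image β)
  have hs : s.card = m + 1 := by
    rw [Finset.card_insert_of_notMem (by simpa using hi),
      Finset.card_image_of_injective _ β.injective, Finset.card_fin]
  have hrange : Set.range (s.orderEmbOfFin hs) = insert i (Set.range β) := by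
    rw [Finset.range_orderEmbOfFin]
    simp [s]
  obtain ⟨p, hp⟩ : i ∈ Set.range (s.orderEmbOfFin hs) := by
    rw [hrange]; exact Set.mem_insert _ _
  refine ⟨s.orderEmbOfFin hs, p, hp, orderEmb_eq_of_range_eq ?_⟩
  rw [range_succAboveOrderEmb_trans, hp, hrange, Set.insert_sdiff_self_of_notMem hi]

theorem neg_one_pow_add_of_succAbove {m : ℕ} {p q : Fin (m + 1 + 1)} {r c : Fin (m + 1)}
    (hq : p.succAbove c = q) (hp : q.succAbove r = p) :
    (-1 : ℝ) ^ (p + q : ℕ) = - (-1) ^ (r + c : ℕ) := by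
  have h : (p + q : ℕ) = r + c + 1 := by
    have h1 := congrArg Fin.val hq
    have h2 := congrArg Fin.val hp
    simp only [Fin.succAbove, Fin.lt_def] at h1 h2
    split_ifs at h1 h2 <;> simp at * <;> omega
  rw [h, pow_succ]
  ring

/-- A negative off-diagonal entry of `B^[k + 1]` comes from an entry `B i j` of `B` and an increasing
sequence `δ` through `i = δ p` and `j = δ q`. -/
theorem exists_of_addCompound_neg {B : Matrix (Fin n) (Fin n) ℝ} {α β : Fin (k + 1) ↪o Fin n}
    (hne : α ≠ β) (h : addCompound (k + 1) B α β < 0) :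
    ∃ (δ : Fin (k + 1 + 1) ↪o Fin n) (p q : Fin (k + 1 + 1)), p ≠ q ∧
      0 < (-1) ^ (p + q : ℕ) * B (δ p) (δ q) := by
  rw [addCompound_apply] at h
  obtain ⟨c, -, hc⟩ := Finset.exists_lt_of_sum_lt (h.trans_eq Finset.sum_const_zero.symm)
  obtain ⟨r, -, hr⟩ := Finset.exists_lt_of_sum_lt (hc.trans_eq Finset.sum_const_zero.symm)
  by_cases hrc : r.succAboveOrderEmb.trans α = c.succAboveOrderEmb.trans β
  swap
  · simp [hrc] at hr
  rw [if_pos hrc, mul_one] at hr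
  have hrange : Set.range α \ {α r} = Set.range β \ {β c} := by
    rw [← range_succAboveOrderEmb_trans, ← range_succAboveOrderEmb_trans, hrc]
  have hαr : α r ∉ Set.range β := fun hmem => hne <| orderEmb_eq_of_range_subset fun i hi => by
    by_cases h : i = α r
    · rwa [h]
    · exact (hrange.le ⟨hi, h⟩).1
  obtain ⟨δ, p, hp, hδ⟩ := exists_insert β hαr
  set q := p.succAbove c with hq
  have hδq : δ q = β c := DFunLike.congr_fun hδ c
  have hα : q.succAboveOrderEmb.trans δ = α := by
    refine orderEmb_eq_of_range_subset ?_
    rw [range_succAboveOrderEmb_trans, hδq]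
    rintro i ⟨hi, hic⟩
    by_cases h : i = α r
    · exact ⟨r, h.symm⟩
    · have : i ∈ Set.range β := by
        rw [← hδ, range_succAboveOrderEmb_trans, hp]
        exact ⟨hi, h⟩
      exact (hrange.ge ⟨this, hic⟩).1
  have hqr : q.succAbove r = p := δ.injective <| by
    rw [hp]
    exact DFunLike.congr_fun hα r
  refine ⟨δ, p, q, (Fin.succAbove_ne p c).symm, ?_⟩
  rw [neg_one_pow_add_of_succAbove hq.symm hqr, hp, hδq]
  linarith

theorem eventually_pos_of_hasDerivAt {f : ℝ → ℝ} {f' t : ℝ} (h : HasDerivAt f f' t)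
    (h0 : f t = 0) (hf' : 0 < f') : ∀ᶠ τ in 𝓝[>] t, 0 < f τ := by
  have h1 := (hasDerivAt_iff_tendsto_slope.1 h).mono_left
    (nhdsWithin_mono t fun τ (hτ : t < τ) => hτ.ne')
  filter_upwards [h1.eventually (lt_mem_nhds hf'), self_mem_nhdsWithin] with τ h2 hτ
  rw [slope_def_field, h0, sub_zero] at h2
  exact (div_pos_iff_of_pos_right (sub_pos.2 hτ)).1 h2

/-- With `i = δ p` and `j = δ q` as in `exists_of_addCompound_neg`, start at the vector with `j`-th
entry about `1`, small entries of alternating signs at the other terms of `δ`, and the entry `0` at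
`i`: it has at most `k` sign variations. Its `i`-th entry moves away from `0` with the sign of
`A i j`, which completes the alternation along `δ`. -/
theorem isMetzler_of_isKPositive (hA : ContinuousOn A (Icc a b))
    (h : IsKPositive (k + 1) A a b) :
    ∀ t ∈ Ioo a b, IsMetzler (addCompound (k + 1) (A t)) := by
  intro t₀ ht₀ α β hne
  by_contra hneg
  obtain ⟨δ, p, q, hpq, hpos⟩ := exists_of_addCompound_neg hne (not_le.1 hneg)
  let γ := p.succAboveOrderEmb.trans δ
  let u : Fin n → ℝ := Function.extend γ (fun s => (-1) ^ (p.succAbove s + q : ℕ)) 0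
  have huγ : ∀ s, u (δ (p.succAbove s)) = (-1) ^ (p.succAbove s + q : ℕ) :=
    fun s => γ.injective.extend_apply _ _ s
  have hu0 : ∀ i, i ∉ Set.range γ → u i = 0 := fun i hi =>
    Function.extend_apply' _ _ _ fun hex => hi hex
  let v : ℝ → Fin n → ℝ := fun η => Pi.single (δ q) 1 + η • u
  have hpγ : δ p ∉ Set.range γ := by
    rw [range_succAboveOrderEmb_trans]
    exact fun hmem => hmem.2 rfl
  have hvp : ∀ η, v η (δ p) = 0 := fun η => by
    simp [v, hu0 _ hpγ, δ.injective.ne hpq]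
  have hderiv : ∀ η, (A t₀).mulVec (v η) (δ p) =
      A t₀ (δ p) (δ q) + η * (A t₀).mulVec u (δ p) := fun η => by
    simp [v, Matrix.mulVec_add, Matrix.mulVec_smul]
  obtain ⟨η, hη0, hη⟩ : ∃ η : ℝ, 0 < η ∧
      0 < (-1) ^ (q : ℕ) * (-1) ^ (p : ℕ) * (A t₀).mulVec (v η) (δ p) := by
    have hcont : Continuous fun η : ℝ => (-1) ^ (q : ℕ) * (-1) ^ (p : ℕ) *
        (A t₀ (δ p) (δ q) + η * (A t₀).mulVec u (δ p)) := by fun_prop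
    have h0 : 0 < (-1) ^ (q : ℕ) * (-1) ^ (p : ℕ) *
        (A t₀ (δ p) (δ q) + 0 * (A t₀).mulVec u (δ p)) := by
      rw [zero_mul, add_zero, mul_comm ((-1 : ℝ) ^ (q : ℕ)), ← pow_add]
      exact hpos
    obtain ⟨η, h1, h2⟩ := ((hcont.tendsto 0).mono_left nhdsWithin_le_nhds |>.eventually
      (lt_mem_nhds h0) |>.and (self_mem_nhdsWithin (s := Ioi (0 : ℝ)))).exists
    exact ⟨η, h2, by rw [hderiv]; exact h1⟩
  have hvγ : ∀ s, 0 < (-1) ^ (q : ℕ) * (-1) ^ (p.succAbove s : ℕ) * v η (δ (p.succAbove s)) :=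
    fun s => by
      have hsq : ∀ m : ℕ, (-1 : ℝ) ^ m * (-1) ^ m = 1 := fun m => by
        rw [← mul_pow]; norm_num
      have h1 : (-1 : ℝ) ^ (q : ℕ) * (-1) ^ (p.succAbove s : ℕ) * u (δ (p.succAbove s)) = 1 := by
        rw [huγ, add_comm (p.succAbove s : ℕ), ← pow_add, hsq]
      simp only [v, Pi.add_apply, Pi.smul_apply, smul_eq_mul, mul_add]
      rw [mul_left_comm _ η, h1, mul_one]
      refine add_pos_of_nonneg_of_pos ?_ hη0
      by_cases hs : p.succAbove s = q
      · rw [hs, Pi.single_eq_same, hsq, mul_one]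
        exact zero_le_one
      · rw [Pi.single_eq_of_ne (δ.injective.ne hs), mul_zero]
  obtain ⟨x, hx0, hx⟩ := exists_isSolution hA (Ioo_subset_Icc_self ht₀) (v η)
  have hmem : x t₀ ∈ PMinus n (k + 1) := by
    refine mem_PMinus_of_support γ fun i hi => ?_
    have hiq : i ≠ δ q := fun hiq => hi <| by
      rw [range_succAboveOrderEmb_trans]
      exact ⟨⟨q, hiq.symm⟩, fun h => hpq (δ.injective (h.symm.trans hiq))⟩
    simp [hx0, v, hu0 i hi, hiq]
  have hev : ∀ᶠ t in 𝓝[>] t₀, ∀ s : Fin (k + 1 + 1),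
      0 < (-1) ^ (q : ℕ) * (-1) ^ (s : ℕ) * x t (δ s) := by
    refine eventually_all.2 fun s => ?_
    by_cases hs : s = p
    · subst hs
      refine eventually_pos_of_hasDerivAt ((hx.hasDerivAt ht₀ (δ s)).const_mul _) ?_ ?_
      · rw [hx0, hvp, mul_zero]
      · rw [hx0]; exact hη
    · obtain ⟨z, rfl⟩ := Fin.exists_succAbove_eq hs
      have hcont := ((hx.hasDerivAt ht₀ (δ (p.succAbove z))).continuousAt.const_mul
        ((-1) ^ (q : ℕ) * (-1) ^ (p.succAbove z : ℕ))).tendsto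
      refine (hcont.mono_left nhdsWithin_le_nhds).eventually (lt_mem_nhds ?_)
      rw [hx0]
      exact hvγ z
  obtain ⟨t, htalt, ht⟩ := (hev.and (Ioo_mem_nhdsGT ht₀.2)).exists
  exact mem_PMinus_iff.1 (h x hx t₀ ht₀.1 ht₀.2 hmem t ht.1.le ht.2)
    ⟨δ, (-1) ^ (q : ℕ), htalt⟩

/-! ### Necessity of irreducibility on a dense set -/

theorem weaklyAlternates_of_eq_zero {x : Fin n → ℝ} {m : ℕ} (α : Fin m ↪o Fin n)
    (hα : ∀ r, x (α r) = 0) {l : Fin n} (hl : l ∉ Set.range α) : WeaklyAlternates x m := by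
  obtain ⟨δ, p, hp, hδ⟩ := exists_insert α hl
  have hne : (-1 : ℝ) ^ (p : ℕ) ≠ 0 := pow_ne_zero _ (by norm_num)
  refine ⟨δ, (-1) ^ (p : ℕ) * if x l = 0 then 1 else x l, ?_, fun s => ?_⟩
  · split_ifs with h <;> simp [h]
  · by_cases hs : s = p
    · subst hs
      rw [hp]
      split_ifs with h
      · simp [h]
      · have : (-1 : ℝ) ^ (s : ℕ) * x l * (-1) ^ (s : ℕ) * x l =
          ((-1) ^ (s : ℕ) * x l) ^ 2 := by ring
        rw [this]
        exact sq_nonneg _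
    · obtain ⟨z, rfl⟩ := Fin.exists_succAbove_eq hs
      have : δ (p.succAbove z) = α z := DFunLike.congr_fun hδ z
      rw [this, hα, mul_zero]

/-- If the times of reducibility fill an interval, then the zero pattern of `A^[k + 1]` has a common
nontrivial block triangular form on a smaller interval. -/
theorem exists_block_triangular_interval (hA : ContinuousOn A (Icc a b))
    (hE : (interior (reducibleTimes k A a b)).Nonempty) :
    ∃ s t, a < s ∧ s < t ∧ t < b ∧ ∃ S : Set (Fin k ↪o Fin n), S.Nonempty ∧ Sᶜ.Nonempty ∧
      ∀ τ ∈ Ioo s t, ∀ α ∈ S, ∀ β ∈ Sᶜ, addCompound k (A τ) α β = 0 := by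
  classical
  -- The set of nonzero entries is lower semicontinuous in time. Take a time `s` in the interval at
  -- which it is as large as possible: it is then constant near `s`.
  let P : ℝ → Finset ((Fin k ↪o Fin n) × (Fin k ↪o Fin n)) := fun τ =>
    Finset.univ.filter fun i => addCompound k (A τ) i.1 i.2 ≠ 0
  set V := interior (reducibleTimes k A a b) with hV
  obtain ⟨s, hs, hmax⟩ : ∃ s ∈ V, ∀ τ ∈ V, (P τ).card ≤ (P s).card := by
    have hfin : ((fun τ => (P τ).card) '' V).Finite :=
      (Set.finite_Iic (Fintype.card ((Fin k ↪o Fin n) × (Fin k ↪o Fin n)))).subset (by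
        rintro _ ⟨τ, -, rfl⟩; exact Finset.card_le_univ _)
    obtain ⟨_, ⟨s, hs, rfl⟩, h⟩ := Set.exists_max_image _ id hfin (hE.image _)
    exact ⟨s, hs, fun τ hτ => h _ ⟨τ, hτ, rfl⟩⟩
  obtain ⟨hsab, hred⟩ := interior_subset hs
  have hev1 : ∀ᶠ τ in 𝓝 s, ∀ i ∈ P s, addCompound k (A τ) i.1 i.2 ≠ 0 := by
    refine (Filter.eventually_all_finset (P s)).2 fun i hi => ?_
    exact ((continuousOn_addCompound hA i.1 i.2).continuousAt
      (Icc_mem_nhds hsab.1 hsab.2)).eventually_ne (by simpa [P] using hi)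
  have hev : ∀ᶠ τ in 𝓝 s, P τ = P s := by
    filter_upwards [hev1, isOpen_interior.mem_nhds hs] with τ h1 h2
    exact (Finset.eq_of_subset_of_card_le (fun i hi => by simpa [P] using h1 i hi)
      (hmax τ h2)).symm
  unfold IsIrreducibleMatrix at hred
  push Not at hred
  obtain ⟨S, hS, hSc, hzero⟩ := hred
  have hev' : ∀ᶠ τ in 𝓝[>] s, P τ = P s ∧ τ < b :=
    nhdsWithin_le_nhds (hev.and (gt_mem_nhds hsab.2))
  obtain ⟨t, hst, ht⟩ := (nhdsGT_basis s).mem_iff.1 hev'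
  refine ⟨s, (s + t) / 2, hsab.1, by linarith, ?_, S, hS, hSc, fun τ hτ α hα β hβ => ?_⟩
  · exact (ht (⟨by linarith, by linarith⟩ : (s + t) / 2 ∈ Ioo s t)).2
  · have h1 : P τ = P s := (ht ⟨hτ.1, by linarith [hτ.2]⟩).1
    have h2 := (Finset.ext_iff.1 h1 (α, β)).not
    simp only [P, Finset.mem_filter, Finset.mem_univ, true_and, not_not] at h2
    exact h2.2 (hzero α hα β hβ)

theorem interior_reducibleTimes_eq_empty (hA : ContinuousOn A (Icc a b))
    (h : IsStronglyKPositive (k + 1) A a b) :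
    interior (reducibleTimes (k + 1) A a b) = ∅ := by
  by_contra hE
  obtain ⟨s, t, has, hst, htb, S, ⟨α, hα⟩, ⟨β, hβ⟩, hS⟩ :=
    exists_block_triangular_interval hA (Set.nonempty_iff_ne_empty.2 hE)
  have hne : β ≠ α := fun h => hβ (h ▸ hα)
  have hsb : s < b := hst.trans htb
  -- Start the matrix solution at the coordinate vectors of `β ∉ S`: its minor `α ∈ S` stays zero,
  -- so that some solution starting from the span of these vectors vanishes along `α` at time `t`.
  obtain ⟨X, hXs, hX⟩ := exists_isMatrixSolution hA (t₀ := s) ⟨has.le, hsb.le⟩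
    ((1 : Matrix (Fin n) (Fin n) ℝ).submatrix id β)
  obtain ⟨C, hC⟩ := exists_bound_addCompound (k + 1) hA
  have hsub : Ioo s t ⊆ Ioo a b := Ioo_subset_Ioo has.le htb.le
  have hzero : minors (X t) α = 0 :=
    eq_zero_of_block_triangular (w := fun τ α => minors (X τ) α) hst.le
      (fun α => (hX.continuousOn_minors α).mono (Icc_subset_Icc has.le htb.le))
      (fun τ hτ α => hX.hasDerivAt_minors (hsub hτ) α)
      (fun τ hτ => hC τ (Ioo_subset_Icc_self (hsub hτ))) hS
      (fun γ hγ => by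
        rw [hXs]
        exact (det_one_submatrix γ β).trans (if_neg fun h : γ = β => hβ (h ▸ hγ))) α hα
  obtain ⟨d, hd, hXd⟩ := Matrix.exists_mulVec_eq_zero_iff.2 hzero
  have hinit : ∀ i, (X s).mulVec d i = ∑ c, (if i = β c then d c else 0) := fun i => by
    rw [hXs]
    simp [Matrix.mulVec, dotProduct, Matrix.one_apply]
  have hmem : (X s).mulVec d ∈ PMinus n (k + 1) := mem_PMinus_of_support β fun i hi => by
    rw [hinit]
    exact Finset.sum_eq_zero fun c _ => if_neg fun h => hi ⟨c, h.symm⟩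
  have hne0 : (X s).mulVec d ≠ 0 := fun h0 => hd <| funext fun c => by
    have := congrFun h0 (β c)
    rw [hinit] at this
    simpa [β.injective.eq_iff] using this
  obtain ⟨l, -, hl⟩ := Set.not_subset.1 fun hsub => hne (orderEmb_eq_of_range_subset hsub)
  exact mem_PPlus_iff.1 (h _ (hX.mulVec d) s has hsb hne0 hmem t hst htb)
    (weaklyAlternates_of_eq_zero α (fun r => congrFun hXd r) hl)

theorem interior_eq_empty_of_forall_not_accPt {E : Set ℝ} (h : ∀ t ∈ E, ¬ AccPt t (𝓟 E)) :
    interior E = ∅ := by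
  refine Set.eq_empty_of_forall_notMem fun t ht => h t (interior_subset ht) ?_
  have : 𝓝[≠] t ≤ 𝓟 E :=
    nhdsWithin_le_nhds.trans (le_principal_iff.2 (mem_interior_iff_mem_nhds.1 ht))
  rw [AccPt, inf_eq_left.2 this]
  infer_instance

end
end KPositive

theorem mainTheorem1 (n k : ℕ) (hk : 1 ≤ k) (hkn : k ≤ n) (a b : ℝ) (hab : a < b)
    (A : ℝ → Matrix (Fin n) (Fin n) ℝ) (hA : ContinuousOn A (Set.Icc a b)) :
    (KPositive.IsKPositive k A a b ↔
      ∀ t ∈ Set.Ioo a b, KPositive.IsMetzler (KPositive.addCompound k (A t))) ∧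
    (KPositive.IsStronglyKPositive k A a b ↔
      (∀ t ∈ Set.Ioo a b, KPositive.IsMetzler (KPositive.addCompound k (A t))) ∧
        interior (KPositive.reducibleTimes k A a b) = ∅) ∧
    ((∀ t ∈ Set.Ioo a b, KPositive.IsMetzler (KPositive.addCompound k (A t))) →
      (∀ t ∈ KPositive.reducibleTimes k A a b,
        ¬ AccPt t (Filter.principal (KPositive.reducibleTimes k A a b))) →
      KPositive.IsStronglyKPositive k A a b) := by
  obtain ⟨k, rfl⟩ : ∃ m, k = m + 1 := ⟨k - 1, (Nat.sub_add_cancel hk).symm⟩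
  refine ⟨⟨KPositive.isMetzler_of_isKPositive hA, KPositive.isKPositive_of_isMetzler hkn hA⟩,
    ⟨fun h => ⟨KPositive.isMetzler_of_isKPositive hA (h.isKPositive hkn hA),
      KPositive.interior_reducibleTimes_eq_empty hA h⟩,
      fun h => KPositive.isStronglyKPositive_of_isMetzler hkn hA h.1 h.2⟩,
    fun hM hE => KPositive.isStronglyKPositive_of_isMetzler hkn hA hM
      (KPositive.interior_eq_empty_of_forall_not_accPt hE)⟩
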